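/- Let $d\ge 1$ and consider the infinite spin chain with sites $\mathbb{Z}$ and local space $\mathbb{C}^d$ at every site. Let $\mathcal{B}_0$ be the space of traceless $d\times d$ matrices. A formal operator is a family $\Phi=\sum_A\Phi(A)$ with $\Phi(A)\in\mathcal{B}_0^{\otimes A}$ for every finite $A\subset\mathbb{Z}$ (and $\mathcal{B}_0^{\otimes\emptyset}=\mathbb{C}$). It is at most $r$-local if $\Phi(A)=0$ whenever $A\neq\emptyset$ and $\max A-\min A+1>r$, local if it is at most $r$-local for some $r$, and translation-invariant if each $\Phi(A+1)$ is the translate of $\Phi(A)$. For $\Phi$ local, $[\Phi,\Psi](A)$ is the component in $\mathcal{B}_0^{\otimes A}$ of $[\Phi|_B,\Psi|_B]$, where $\Phi|_B=\sum_{A'\subseteq B}\Phi(A')$ and $B\supseteq A$ is any sufficiently large finite set; $\Psi$ is a conserved quantity of $\Phi$ if $[\Phi,\Psi]=0$. Let $U\subseteq\mathbb{R}^D$ be open and $v:U\to\mathbb{R}^D$ smooth. For $\lambda\in U$ let $$H(\lambda)=\sum_{i\in\mathbb{Z}}h^{(2)}_i(\lambda)+\sum_{i\in\mathbb{Z}}h^{(1)}_i(\lambda),\qquad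 h^{(2)}_i(\lambda)\in\mathcal{B}_0^{\otimes\{i,i+1\}},\quad h^{(1)}_i(\lambda)\in\mathcal{B}_0^{\otimes\{i\}},$$ be a Hermitian, translation-invariant nearest-neighbour Hamiltonian that depends smoothly on $\lambda$, and let $C(\lambda)$ be a translation-invariant, at most one-local formal operator that depends smoothly on $\lambda$. Put $B_{H(\lambda)}=\sum_{j\in\mathbb{Z}}j\,\bigl(h^{(2)}_j(\lambda)+h^{(1)}_j(\lambda)\bigr)+C(\lambda)$ and define, for $\lambda\in U$, $$Q^{(2)}(\lambda)=H(\lambda),\qquad Q^{(n+1)}(\lambda)=[B_{H(\lambda)},Q^{(n)}(\lambda)]+(v\cdot\nabla)Q^{(n)}(\lambda)\quad(n\ge 2),$$ where $v\cdot\nabla=\sum_{a=1}^D v_a\,\partial_{\lambda_a}$ acts on each component. If $Q^{(3)}(\lambda)$ is a conserved quantity of $H(\lambda)$ for every $\lambda\in U$ (the generalized Reshetikhin condition), then for every $n\ge 2$ the operators $Q^{(n)}(\lambda)$ are well-defined, at most $n$-local and smooth in $\lambda$, and $Q^{(n)}(\lambda)$ is a translation-invariant conserved quantity of $H(\lambda)$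 for every $\lambda\in U$. Moreover $[Q^{(m)}(\lambda),Q^{(n)}(\lambda)]=0$ for all $m,n\ge 2$ and $\lambda\in U$. -/

import Mathlib

open scoped ContDiff

namespace SpinChain

/-- Operators on `(ℂ^d)^{⊗A}` for a finite set `A ⊂ ℤ` of sites, as matrices in the product
basis, which is indexed by the spin configurations `A → Fin d`. -/
abbrev Op (d : ℕ) (A : Finset ℤ) : Type := Matrix (A → Fin d) (A → Fin d) ℂ

/-- `X` lies in `𝓑₀^{⊗A}`: its partial trace over each single site of `A` vanishes
(no condition for `A = ∅`). -/
def IsTracelessOp {d : ℕ} {A : Finset ℤ} (X : Op d A) : Prop :=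
  ∀ (i : A) (s t : A → Fin d),
    ∑ k : Fin d, X (Function.update s i k) (Function.update t i k) = 0

/-- The embedding `X ↦ X ⊗ I_{B∖A}` of operators on `A` into operators on `B ⊇ A`. -/
def embed {d : ℕ} {A B : Finset ℤ} (h : A ⊆ B) (X : Op d A) : Op d B := fun s t =>
  if ∀ i : B, (i : ℤ) ∉ A → s i = t i then
    X (Finset.restrict₂ (π := fun _ => Fin d) h s) (Finset.restrict₂ (π := fun _ => Fin d) h t)
  else 0

/-- The configuration on `B` equal to `s` on `A` and to `u` on `B ∖ A`. -/
def glue {d : ℕ} {A B : Finset ℤ} (s : A → Fin d) (u : ↥(B \ A) → Fin d) : B → Fin d :=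
  fun i => if hi : (i : ℤ) ∈ A then s ⟨i, hi⟩ else u ⟨i, Finset.mem_sdiff.2 ⟨i.2, hi⟩⟩

/-- The normalized partial trace `d^{-|B∖A|} Tr_{B∖A}` from operators on `B` to operators
on `A` (used for `A ⊆ B`). -/
noncomputable def partialTrace {d : ℕ} {A B : Finset ℤ} (Y : Op d B) : Op d A := fun s t =>
  ((d : ℂ) ^ (B \ A).card)⁻¹ * ∑ u : ↥(B \ A) → Fin d, Y (glue s u) (glue t u)

/-- The component `Y_A ∈ 𝓑₀^{⊗A}` of `Y ∈ 𝓑^{⊗B} = ⨁_{A ⊆ B} 𝓑₀^{⊗A}` (used for `A ⊆ B`), by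
inclusion-exclusion over `C ⊆ A`. -/
noncomputable def component {d : ℕ} {B : Finset ℤ} (A : Finset ℤ) (Y : Op d B) : Op d A :=
  ∑ C ∈ A.powerset.attach,
    (-1 : ℂ) ^ (A \ C.1).card •
      embed (Finset.mem_powerset.1 C.2) (partialTrace (A := C.1) Y)

/-- Families `A ↦ Φ(A)` of operators indexed by the finite subsets of `ℤ`; the formal operators
on the infinite chain are those with `IsTraceless`. -/
abbrev FormalOp (d : ℕ) : Type := (A : Finset ℤ) → Op d A

/-- `Φ(A) ∈ 𝓑₀^{⊗A}` for all `A`. -/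
def IsTraceless {d : ℕ} (Φ : FormalOp d) : Prop := ∀ A, IsTracelessOp (Φ A)

/-- `Φ† = Φ`. -/
def IsSelfAdj {d : ℕ} (Φ : FormalOp d) : Prop := ∀ A, (Φ A).IsHermitian

/-- The range `max A - min A + 1` of a finite set, `0` for the empty set. -/
noncomputable def setRange (A : Finset ℤ) : ℕ :=
  if h : A.Nonempty then (A.max' h - A.min' h + 1).toNat else 0

/-- The range of a formal operator, `sup {r(A) | Φ(A) ≠ 0}`. The operator is at most `r`-local
when this is at most `r`, and local when it is finite. -/
noncomputable def opRange {d : ℕ} (Φ : FormalOp d) : ℕ∞ :=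
  ⨆ (A : Finset ℤ) (_ : Φ A ≠ 0), (setRange A : ℕ∞)

/-- The translate `A + 1`. -/
def shift (A : Finset ℤ) : Finset ℤ := A.map (addRightEmbedding (1 : ℤ))

theorem sub_one_mem {A : Finset ℤ} (i : shift A) : (i : ℤ) - 1 ∈ A := by
  obtain ⟨i, hi⟩ := i
  simp only [shift, Finset.mem_map, addRightEmbedding_apply] at hi
  obtain ⟨a, ha, rfl⟩ := hi
  simpa using ha

/-- The spin configuration on `A + 1` obtained by translating one on `A`. -/
def shiftConfig {d : ℕ} {A : Finset ℤ} (s : A → Fin d) : shift A → Fin d :=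
  fun i => s ⟨(i : ℤ) - 1, sub_one_mem i⟩

/-- The translation superoperator `(𝒯 Φ)(A) = τ_A(1)† Φ(A + 1) τ_A(1)`. -/
def translate {d : ℕ} (Φ : FormalOp d) : FormalOp d :=
  fun A => (Φ (shift A)).submatrix shiftConfig shiftConfig

/-- `𝒯 Φ = Φ`. -/
def IsTranslationInvariant {d : ℕ} (Φ : FormalOp d) : Prop := translate Φ = Φ

/-- The restriction `Φ|_B = ∑_{A ⊆ B} Φ(A)`, an operator on `B`. -/
def restrictTo {d : ℕ} (Φ : FormalOp d) (B : Finset ℤ) : Op d B :=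
  ∑ A ∈ B.powerset.attach, embed (Finset.mem_powerset.1 A.2) (Φ A.1)

/-- The set of sites at distance at most `r` from `A`. -/
noncomputable def thicken (r : ℕ) (A : Finset ℤ) : Finset ℤ :=
  A.biUnion fun i => Finset.Icc (i - r) (i + r)

/-- The commutator of a local formal operator `Φ` with a formal operator `Ψ`:
`[Φ, Ψ](A) = [Φ|_B, Ψ|_B]_A` for any sufficiently large finite set `B`. The set `B` of all sites
within distance `r(Φ)` of `A` is large enough: a term `[Φ(C), Ψ(C')]` has a nonzero
component on `A` only if `C` meets `A` and `C' ⊆ C ∪ A`. -/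
noncomputable def comm {d : ℕ} (Φ Ψ : FormalOp d) : FormalOp d := fun A =>
  component A
    (restrictTo Φ (thicken (opRange Φ).toNat A) * restrictTo Ψ (thicken (opRange Φ).toNat A) -
      restrictTo Ψ (thicken (opRange Φ).toNat A) * restrictTo Φ (thicken (opRange Φ).toNat A))

/-- `Ψ` is a conserved quantity of `Φ`. -/
def IsConserved {d : ℕ} (Φ Ψ : FormalOp d) : Prop := comm Φ Ψ = 0

/-- `Φ = ∑ᵢ h²ᵢ + ∑ᵢ h¹ᵢ` consists of on-site terms `h¹ᵢ = Φ({i})` and nearest-neighbour terms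
`h²ᵢ = Φ({i, i+1})` only. -/
def IsNearestNeighbor {d : ℕ} (Φ : FormalOp d) : Prop :=
  ∀ A : Finset ℤ, Φ A ≠ 0 → ∃ i : ℤ, A = {i} ∨ A = {i, i + 1}

/-- The leftmost site of a nonempty `A`. -/
def leftmost (A : Finset ℤ) : ℤ := if h : A.Nonempty then A.min' h else 0

/-- The boost operator `∑ⱼ j (h²ⱼ + h¹ⱼ) + C` of a nearest-neighbour `H = ∑ⱼ h²ⱼ + ∑ⱼ h¹ⱼ`. -/
noncomputable def boost {d : ℕ} (H C : FormalOp d) : FormalOp d :=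
  fun A => (leftmost A : ℂ) • H A + C A

/-- A family of formal operators depends smoothly on the parameter in `U`
(all matrix entries of all components do). -/
def IsSmoothOn {d D : ℕ} (U : Set (EuclideanSpace ℝ (Fin D)))
    (Φ : EuclideanSpace ℝ (Fin D) → FormalOp d) : Prop :=
  ∀ (A : Finset ℤ) (s t : A → Fin d), ContDiffOn ℝ ∞ (fun p => Φ p A s t) U

/-- The derivative `(v · ∇) Φ` of a family of formal operators along the vector field `v`. -/
noncomputable def dirDeriv {d D : ℕ}
    (v : EuclideanSpace ℝ (Fin D) → EuclideanSpace ℝ (Fin D))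
    (Φ : EuclideanSpace ℝ (Fin D) → FormalOp d) :
    EuclideanSpace ℝ (Fin D) → FormalOp d :=
  fun p A => Matrix.of fun s t => fderiv ℝ (fun q => Φ q A s t) p (v p)

/-- The operators `Q⁽ⁿ⁾`: `Q⁽²⁾ = H` and `Q⁽ⁿ⁺¹⁾ = [𝔅_H, Q⁽ⁿ⁾] + (v · ∇) Q⁽ⁿ⁾` for `n ≥ 2`
(the values at `n = 0, 1` are not used). -/
noncomputable def charge {d D : ℕ}
    (v : EuclideanSpace ℝ (Fin D) → EuclideanSpace ℝ (Fin D))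
    (H C : EuclideanSpace ℝ (Fin D) → FormalOp d) :
    ℕ → EuclideanSpace ℝ (Fin D) → FormalOp d
  | 0 => 0
  | 1 => 0
  | 2 => H
  | n + 3 => fun p =>
      comm (boost (H p) (C p)) (charge v H C (n + 2) p) + dirDeriv v (charge v H C (n + 2)) p

end SpinChain

/-! The map `D = [B_H, ·] + v · ∇` is a derivation of the commutator, by the Jacobi identity and the
Leibniz rule, and `D Q⁽ⁿ⁾ = Q⁽ⁿ⁺¹⁾`. Applying it to `[H, Q⁽ⁿ⁾] = 0` gives `[Q⁽³⁾, Q⁽ⁿ⁾] + [H,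
Q⁽ⁿ⁺¹⁾] = 0`. By Jacobi, `H` commutes with the first term, since it commutes with `Q⁽³⁾` and `Q⁽ⁿ⁾`.
Hence `[H, [H, Q⁽ⁿ⁺¹⁾]] = 0`.

The decisive point is that one `H` can be removed (`comm_eq_zero_of_comm_comm_eq_zero`). On
translation-invariant local operators the trace per site is a positive semidefinite form that sees
every component except the one at `∅`, and `ad H` is symmetric for it because `H` is Hermitian. With
`K = [H, Q]` this gives `⟨K, K⟩ = ⟨Q, [H, K]⟩` up to conjugation, which is zero, so `K = 0`. The
argument needs `Q⁽ⁿ⁺¹⁾` to be translation-invariant although the boost is not: translation changes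
the boost by `H`, and `[H, Q⁽ⁿ⁾] = 0`.

Mutual commutation follows by applying `D` to `[Q⁽ᵐ⁾, Q⁽ⁿ⁾] = 0` and inducting on `m`.

On the infinite chain every commutator is a component of a finite-region commutator. `comm_eq` makes
the region arbitrary once it is large, and `comm_comm_eq` does the same for double commutators; the
algebraic identities then reduce to matrix identities in one common region. -/

namespace SpinChain

variable {d : ℕ} {A B C S : Finset ℤ}

/-! ### Embeddings and partial traces -/

/-- The restriction of a configuration. -/
abbrev res (h : A ⊆ B) (s : B → Fin d) : A → Fin d := fun i => s ⟨i, h i.2⟩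

/-- The configuration `s` with its values on `A` replaced by those of `v`. -/
def overlay (s : B → Fin d) (v : A → Fin d) : B → Fin d :=
  fun i => if hi : (i : ℤ) ∈ A then v ⟨i, hi⟩ else s i

theorem embed_apply (h : A ⊆ B) (X : Op d A) (s t : B → Fin d) :
    embed h X s t =
      if ∀ i : B, (i : ℤ) ∉ A → s i = t i then X (res h s) (res h t) else 0 := rfl

theorem res_overlay (h : A ⊆ B) (s : B → Fin d) (v : A → Fin d) : res h (overlay s v) = v := by
  funext i; simp [res, overlay]

theorem overlay_res (h : A ⊆ B) (s u : B → Fin d) (hs : ∀ i : B, (i : ℤ) ∉ A → s i = u i) :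
    overlay s (res h u) = u := by
  funext i
  by_cases hi : (i : ℤ) ∈ A
  · simp [overlay, hi]
  · simp [overlay, hi, hs i hi]

theorem overlay_injective (h : A ⊆ B) (s : B → Fin d) :
    Function.Injective (overlay s : (A → Fin d) → B → Fin d) := fun v w hvw => by
  rw [← res_overlay h s v, hvw, res_overlay]

/-- Row `s` of `embed h X` is supported on the configurations that agree with `s` off `A`, which are
the `overlay s v`. -/
theorem embed_mul_apply (h : A ⊆ B) (X : Op d A) (Y : Op d B) (s t : B → Fin d) :
    (embed h X * Y) s t = ∑ v, X (res h s) v * Y (overlay s v) t := by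
  rw [Matrix.mul_apply]
  symm
  refine Fintype.sum_of_injective _ (overlay_injective h s) _ _ ?_ ?_
  · intro u hu
    rw [embed_apply, if_neg, zero_mul]
    intro hs
    exact hu ⟨res h u, overlay_res h s u hs⟩
  · intro v
    rw [embed_apply, if_pos, res_overlay]
    intro i hi
    simp [overlay, hi]

theorem embed_add (h : A ⊆ B) (X Y : Op d A) : embed h (X + Y) = embed h X + embed h Y := by
  ext s t
  simp only [embed_apply, Matrix.add_apply]
  split_ifs <;> simp

theorem embed_smul (h : A ⊆ B) (c : ℂ) (X : Op d A) : embed h (c • X) = c • embed h X := by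
  ext s t
  simp only [embed_apply, Matrix.smul_apply]
  split_ifs <;> simp

/-- `embed` as a linear map. -/
def embedLin (d : ℕ) (h : A ⊆ B) : Op d A →ₗ[ℂ] Op d B where
  toFun := embed h
  map_add' := embed_add h
  map_smul' := embed_smul h

theorem embed_zero (h : A ⊆ B) : embed h (0 : Op d A) = 0 := (embedLin d h).map_zero

theorem embed_sub (h : A ⊆ B) (X Y : Op d A) : embed h (X - Y) = embed h X - embed h Y :=
  (embedLin d h).map_sub X Y

theorem embed_sum {ι : Type*} (h : A ⊆ B) (s : Finset ι) (f : ι → Op d A) :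
    embed h (∑ i ∈ s, f i) = ∑ i ∈ s, embed h (f i) := map_sum (embedLin d h) f s

theorem embed_conjTranspose (h : A ⊆ B) (X : Op d A) :
    embed h X.conjTranspose = (embed h X).conjTranspose := by
  ext s t
  simp only [embed_apply, Matrix.conjTranspose_apply, eq_comm (a := s _)]
  split_ifs <;> simp

theorem embed_embed (h : A ⊆ B) (h' : B ⊆ C) (X : Op d A) :
    embed h' (embed h X) = embed (h.trans h') X := by
  ext s t
  simp only [embed_apply]
  by_cases hs : ∀ i : C, (i : ℤ) ∉ A → s i = t i
  · have hs' : ∀ i : C, (i : ℤ) ∉ B → s i = t i := fun i hi => hs i fun hA => hi (h hA)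
    have hs'' : ∀ i : B, (i : ℤ) ∉ A → res h' s i = res h' t i := fun i hi => hs _ hi
    simp only [if_pos hs, if_pos hs', if_pos hs'']
  · rw [if_neg hs]
    by_cases hs' : ∀ i : C, (i : ℤ) ∉ B → s i = t i
    · rw [if_pos hs', if_neg]
      intro hs''
      refine hs fun i hi => ?_
      by_cases hiB : (i : ℤ) ∈ B
      · exact hs'' ⟨i, hiB⟩ hi
      · exact hs' i hiB
    · rw [if_neg hs']

theorem embed_self (h : A ⊆ A) (X : Op d A) : embed h X = X := by
  ext s t
  rw [embed_apply, if_pos fun i hi => absurd i.2 hi]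

theorem embed_mul (h : A ⊆ B) (X Y : Op d A) : embed h (X * Y) = embed h X * embed h Y := by
  ext s t
  rw [embed_mul_apply]
  simp only [embed_apply, Matrix.mul_apply, res_overlay]
  by_cases hs : ∀ i : B, (i : ℤ) ∉ A → s i = t i
  · rw [if_pos hs]
    refine Finset.sum_congr rfl fun v _ => ?_
    rw [if_pos]
    intro i hi
    simp [overlay, hi, hs i hi]
  · rw [if_neg hs]
    symm
    refine Finset.sum_eq_zero fun v _ => ?_
    rw [if_neg, mul_zero]
    intro h'
    refine hs fun i hi => ?_
    simpa [overlay, hi] using h' i hi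

/-- The factor on `C` forces the intermediate configuration to agree with `t` on `A`, so one summand
survives. The resulting formula is symmetric in the two factors, whence `embed_commute`. -/
theorem embed_mul_embed_apply (hA : A ⊆ B) (hC : C ⊆ B) (h : Disjoint A C)
    (X : Op d A) (Y : Op d C) (s t : B → Fin d) :
    (embed hA X * embed hC Y) s t =
      if ∀ i : B, (i : ℤ) ∉ A → (i : ℤ) ∉ C → s i = t i then
        X (res hA s) (res hA t) * Y (res hC s) (res hC t) else 0 := by
  have hC' : ∀ v : A → Fin d, res hC (overlay s v) = res hC s := by
    intro v
    funext i
    have : (i : ℤ) ∉ A := Finset.disjoint_right.1 h i.2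
    simp [res, overlay, this]
  rw [embed_mul_apply, Finset.sum_eq_single (res hA t)]
  · rw [embed_apply, hC']
    by_cases hs : ∀ i : B, (i : ℤ) ∉ A → (i : ℤ) ∉ C → s i = t i
    · rw [if_pos hs, if_pos]
      intro i hi
      by_cases hiA : (i : ℤ) ∈ A
      · simp [overlay, hiA]
      · simp [overlay, hiA, hs i hiA hi]
    · rw [if_neg hs, if_neg, mul_zero]
      intro hs'
      refine hs fun i hiA hiC => ?_
      simpa [overlay, hiA] using hs' i hiC
  · intro v _ hv
    rw [embed_apply, if_neg, mul_zero]
    intro hs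
    refine hv (funext fun i => ?_)
    have := hs ⟨i, hA i.2⟩ (Finset.disjoint_left.1 h i.2)
    simpa [overlay] using this
  · simp

theorem embed_commute (hA : A ⊆ B) (hC : C ⊆ B) (h : Disjoint A C)
    (X : Op d A) (Y : Op d C) : embed hA X * embed hC Y = embed hC Y * embed hA X := by
  ext s t
  rw [embed_mul_embed_apply hA hC h, embed_mul_embed_apply hC hA h.symm, mul_comm]
  refine if_congr ?_ rfl rfl
  exact ⟨fun H i h1 h2 => H i h2 h1, fun H i h1 h2 => H i h2 h1⟩

/-- Configurations on `B` as pairs of configurations on `A` and `B ∖ A`. -/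
def glueEquiv (d : ℕ) (h : A ⊆ B) : (A → Fin d) × (↥(B \ A) → Fin d) ≃ (B → Fin d) where
  toFun p := glue p.1 p.2
  invFun s := (res h s, res Finset.sdiff_subset s)
  left_inv p := by
    refine Prod.ext (funext fun i => ?_) (funext fun i => ?_)
    · simp [glue, res]
    · have := (Finset.mem_sdiff.1 i.2).2
      simp [glue, res, this]
  right_inv s := by
    funext i
    by_cases hi : (i : ℤ) ∈ A <;> simp [glue, res, hi]

theorem overlay_glue (s v : A → Fin d) (u : ↥(B \ A) → Fin d) :
    overlay (glue s u) v = glue v u := by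
  funext i
  by_cases hi : (i : ℤ) ∈ A <;> simp [glue, overlay, hi]

/-- The normalized trace. -/
noncomputable def ntr (X : Op d B) : ℂ := ((d : ℂ) ^ B.card)⁻¹ * X.trace

theorem ntr_mul_comm (X Y : Op d B) : ntr (X * Y) = ntr (Y * X) := by
  rw [ntr, ntr, Matrix.trace_mul_comm]

theorem ntr_sub (X Y : Op d B) : ntr (X - Y) = ntr X - ntr Y := by
  simp [ntr, mul_sub]

theorem ntr_zero : ntr (0 : Op d B) = 0 := by simp [ntr]

theorem ntr_sum {ι : Type*} (s : Finset ι) (f : ι → Op d B) :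
    ntr (∑ i ∈ s, f i) = ∑ i ∈ s, ntr (f i) := by
  simp [ntr, Matrix.trace_sum, Finset.mul_sum]

theorem partialTrace_add (X Y : Op d B) :
    (partialTrace (X + Y) : Op d A) = partialTrace X + partialTrace Y := by
  ext s t
  simp [partialTrace, Finset.sum_add_distrib, mul_add]

theorem partialTrace_smul (c : ℂ) (X : Op d B) :
    (partialTrace (c • X) : Op d A) = c • partialTrace X := by
  ext s t
  simp [partialTrace, ← Finset.mul_sum, mul_left_comm]

/-- Links the single-site sums of `IsTracelessOp` to `partialTrace`. -/
theorem embed_partialTrace_erase (i : B) (Y : Op d B) (s t : B → Fin d) :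
    embed (B.erase_subset (i : ℤ)) (partialTrace Y) s t =
      if s i = t i then
        (d : ℂ)⁻¹ * ∑ k : Fin d, Y (Function.update s i k) (Function.update t i k) else 0 := by
  have hsd : B \ B.erase (i : ℤ) = {(i : ℤ)} := by
    ext x; simp only [Finset.mem_sdiff, Finset.mem_erase, Finset.mem_singleton]
    constructor
    · intro h; by_contra hx; exact h.2 ⟨hx, h.1⟩
    · rintro rfl; exact ⟨i.2, fun h => h.1 rfl⟩
  have hmem : ∀ x : ↥(B \ B.erase (i : ℤ)), (x : ℤ) = i := fun x => by
    exact Finset.mem_singleton.1 (hsd ▸ x.2)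
  rw [embed_apply]
  refine if_congr ?_ ?_ rfl
  · constructor
    · intro h; exact h i (by simp)
    · intro h j hj
      have : j = i := Subtype.ext (by by_contra hji; exact hj (Finset.mem_erase.2 ⟨hji, j.2⟩))
      rw [this, h]
  · have hcard : (B \ B.erase (i : ℤ)).card = 1 := by rw [hsd, Finset.card_singleton]
    simp only [partialTrace, hcard, pow_one]
    congr 1
    have hglue : ∀ (s : B → Fin d) (k : Fin d),
        glue (res (B.erase_subset (i : ℤ)) s) (fun _ => k) = Function.update s i k := by
      intro s k
      funext j
      by_cases hj : j = i
      · subst hj; simp [glue]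
      · have : (j : ℤ) ∈ B.erase (i : ℤ) :=
          Finset.mem_erase.2 ⟨fun h => hj (Subtype.ext h), j.2⟩
        simp [glue, hj, this]
    refine (Fintype.sum_bijective (fun k : Fin d => fun _ => k) ⟨?_, ?_⟩ _ _ ?_).symm
    · intro k l hkl
      exact congrFun hkl ⟨i, by rw [hsd]; exact Finset.mem_singleton_self _⟩
    · intro u
      refine ⟨u ⟨i, by rw [hsd]; exact Finset.mem_singleton_self _⟩, funext fun x => ?_⟩
      exact congrArg u (Subtype.ext (hmem x).symm)
    · intro k
      rw [← hglue, ← hglue]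

/-! ### Normalized traces and the adjointness of embedding and partial trace. -/

variable [NeZero d]

/-- Embedding and partial trace are adjoint for the trace pairing. Together with the nondegeneracy
`op_ext`, this yields the partial trace identities below without further index computations. -/
theorem ntr_embed_mul (h : A ⊆ B) (X : Op d A) (Y : Op d B) :
    ntr (embed h X * Y) = ntr (X * partialTrace Y) := by
  have hd : (d : ℂ) ≠ 0 := Nat.cast_ne_zero.2 (NeZero.ne d)
  have hcard : (d : ℂ) ^ B.card = d ^ A.card * d ^ (B \ A).card := by
    rw [← pow_add, Finset.card_sdiff_of_subset h, Nat.add_sub_of_le (Finset.card_le_card h)]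
  have key : (embed h X * Y).trace =
      ∑ x : A → Fin d, ∑ v : A → Fin d, X x v * ∑ u : ↥(B \ A) → Fin d,
        Y (glue v u) (glue x u) := by
    simp only [Matrix.trace, Matrix.diag_apply, embed_mul_apply]
    rw [← (glueEquiv d h).sum_comp, Fintype.sum_prod_type]
    refine Finset.sum_congr rfl fun x _ => ?_
    rw [Finset.sum_comm]
    refine Finset.sum_congr rfl fun v _ => ?_
    rw [Finset.mul_sum]
    refine Finset.sum_congr rfl fun u _ => ?_
    have h1 : res h (glueEquiv d h (x, u)) = x :=
      congrArg Prod.fst ((glueEquiv d h).left_inv (x, u))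
    have h2 : overlay (glueEquiv d h (x, u)) v = glue v u := overlay_glue x v u
    rw [h1, h2]
    rfl
  rw [ntr, ntr, key, hcard, mul_inv, mul_assoc]
  congr 1
  simp only [Matrix.trace, Matrix.diag_apply, Matrix.mul_apply, Finset.mul_sum, partialTrace]
  refine Finset.sum_congr rfl fun x _ => Finset.sum_congr rfl fun v _ =>
    Finset.sum_congr rfl fun u _ => ?_
  ring

theorem op_ext {X Y : Op d A} (h : ∀ Z : Op d A, ntr (Z * X) = ntr (Z * Y)) : X = Y := by
  have hd : (d : ℂ) ≠ 0 := Nat.cast_ne_zero.2 (NeZero.ne d)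
  refine Matrix.ext_iff_trace_mul_left.2 fun Z => ?_
  exact mul_left_cancel₀ (inv_ne_zero (pow_ne_zero _ hd)) (h Z)

theorem ntr_embed (h : A ⊆ B) (X : Op d A) : ntr (embed h X) = ntr X := by
  have hp : (partialTrace (1 : Op d B) : Op d A) = 1 := by
    have hd : (d : ℂ) ≠ 0 := Nat.cast_ne_zero.2 (NeZero.ne d)
    ext s t
    have hiff : ∀ u : ↥(B \ A) → Fin d, glue (B := B) s u = glue t u ↔ s = t := by
      intro u
      refine ⟨fun hst => ?_, fun hst => by rw [hst]⟩
      exact congrArg Prod.fst ((glueEquiv d h).injective (a₁ := (s, u)) (a₂ := (t, u)) hst)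
    simp only [partialTrace, Matrix.one_apply, hiff]
    split_ifs
    · rw [Finset.sum_const, Finset.card_univ, Fintype.card_fun, Fintype.card_fin,
        Fintype.card_coe, nsmul_eq_mul, Nat.cast_pow, mul_one]
      exact inv_mul_cancel₀ (pow_ne_zero _ hd)
    · simp
  have := ntr_embed_mul h X 1
  rwa [mul_one, hp, mul_one] at this

theorem partialTrace_partialTrace (h : A ⊆ B) (h' : B ⊆ C) (Y : Op d C) :
    (partialTrace (partialTrace Y : Op d B) : Op d A) = partialTrace Y := by
  refine op_ext fun Z => ?_
  rw [← ntr_embed_mul h, ← ntr_embed_mul h', embed_embed, ← ntr_embed_mul (h.trans h')]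

theorem partialTrace_embed_mul (h : A ⊆ B) (X : Op d A) (Y : Op d B) :
    (partialTrace (embed h X * Y) : Op d A) = X * partialTrace Y := by
  refine op_ext fun Z => ?_
  rw [← ntr_embed_mul h, ← mul_assoc, ← embed_mul, ntr_embed_mul, mul_assoc]

theorem partialTrace_mul_embed (h : A ⊆ B) (X : Op d A) (Y : Op d B) :
    (partialTrace (Y * embed h X) : Op d A) = partialTrace Y * X := by
  refine op_ext fun Z => ?_
  rw [← ntr_embed_mul h, ← mul_assoc, ntr_mul_comm, ← mul_assoc, ← embed_mul, ntr_embed_mul,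
    mul_assoc, ntr_mul_comm, mul_assoc]

theorem partialTrace_embed (h : A ⊆ B) (X : Op d A) :
    (partialTrace (embed h X) : Op d A) = X := by
  refine op_ext fun Z => ?_
  rw [← ntr_embed_mul h, ← embed_mul, ntr_embed]

theorem partialTrace_self (X : Op d A) : (partialTrace X : Op d A) = X := by
  conv_lhs => rw [← embed_self subset_rfl X]
  exact partialTrace_embed _ X

/-- A partial trace is cyclic with respect to operators supported on traced-out sites. -/
theorem partialTrace_mul_comm (hS : S ⊆ B) (hC : C ⊆ B) (h : Disjoint S C) (X : Op d S)
    (Y : Op d B) :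
    (partialTrace (embed hS X * Y) : Op d C) = partialTrace (Y * embed hS X) := by
  refine op_ext fun Z => ?_
  rw [← ntr_embed_mul hC, ← ntr_embed_mul hC, ← mul_assoc, ← mul_assoc,
    ntr_mul_comm _ (embed hS X), ← mul_assoc, embed_commute hS hC h]

theorem embed_injective (h : A ⊆ B) : Function.Injective (embed h : Op d A → Op d B) :=
  fun X Y hXY => by rw [← partialTrace_embed h X, hXY, partialTrace_embed]

end SpinChain

namespace SpinChain

variable {d : ℕ} {A B C S T : Finset ℤ}

/-! ### Components -/

/-- The embedding of operators on `A` into operators on `B`, zero unless `A ⊆ B`. -/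
noncomputable def emb (B : Finset ℤ) (X : Op d A) : Op d B :=
  if h : A ⊆ B then embed h X else 0

theorem emb_of_subset (h : A ⊆ B) (X : Op d A) : emb B X = embed h X := dif_pos h

theorem emb_zero : emb B (0 : Op d A) = 0 := by
  rw [emb]; split_ifs with h
  · exact embed_zero h
  · rfl

theorem emb_add (X Y : Op d A) : emb B (X + Y) = emb B X + emb B Y := by
  rw [emb, emb, emb]; split_ifs with h
  · exact embed_add h X Y
  · simp

theorem emb_smul (c : ℂ) (X : Op d A) : emb B (c • X) = c • emb B X := by
  rw [emb, emb]; split_ifs with h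
  · exact embed_smul h c X
  · simp

theorem emb_sum {ι : Type*} (s : Finset ι) (f : ι → Op d A) :
    emb B (∑ i ∈ s, f i) = ∑ i ∈ s, emb B (f i) := by
  induction s using Finset.cons_induction with
  | empty => simp [emb_zero]
  | cons a s ha ih => rw [Finset.sum_cons, Finset.sum_cons, emb_add, ih]

theorem emb_emb (h : A ⊆ B) (h' : B ⊆ C) (X : Op d A) : emb C (emb B X) = emb C X := by
  rw [emb_of_subset h, emb_of_subset h', emb_of_subset (h.trans h'), embed_embed]

theorem emb_partialTrace_congr (h : A = C) (Y : Op d T) :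
    emb B (partialTrace Y : Op d A) = emb B (partialTrace Y : Op d C) := by
  subst h; rfl

/-- `partialTrace` as a linear map. -/
noncomputable def partialTraceLin (d : ℕ) (A B : Finset ℤ) : Op d B →ₗ[ℂ] Op d A where
  toFun := partialTrace
  map_add' := partialTrace_add
  map_smul' := partialTrace_smul

theorem component_eq_sum (A : Finset ℤ) (Y : Op d B) :
    component A Y =
      ∑ C ∈ A.powerset, (-1 : ℂ) ^ (A \ C).card • emb A (partialTrace Y : Op d C) := by
  rw [component, ← Finset.sum_attach A.powerset]
  refine Finset.sum_congr rfl fun C _ => ?_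
  rw [emb_of_subset (Finset.mem_powerset.1 C.2)]

theorem component_add (X Y : Op d B) : component A (X + Y) = component A X + component A Y := by
  simp only [component_eq_sum, partialTrace_add, emb_add, smul_add, Finset.sum_add_distrib]

theorem component_smul (c : ℂ) (X : Op d B) : component A (c • X) = c • component A X := by
  simp only [component_eq_sum, partialTrace_smul, emb_smul, Finset.smul_sum]
  exact Finset.sum_congr rfl fun _ _ => smul_comm _ _ _

/-- `component A` as a linear map. -/
noncomputable def componentLin (d : ℕ) (A B : Finset ℤ) : Op d B →ₗ[ℂ] Op d A where
  toFun := component A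
  map_add' := component_add
  map_smul' := component_smul

theorem component_zero : component A (0 : Op d B) = 0 := (componentLin d A B).map_zero

theorem component_neg (X : Op d B) : component A (-X) = -component A X :=
  (componentLin d A B).map_neg X

theorem component_sub (X Y : Op d B) : component A (X - Y) = component A X - component A Y :=
  (componentLin d A B).map_sub X Y

theorem component_sum {ι : Type*} (s : Finset ι) (f : ι → Op d B) :
    component A (∑ i ∈ s, f i) = ∑ i ∈ s, component A (f i) :=
  map_sum (componentLin d A B) f s

/-- The terms of `C` and `insert i C` cancel: equal values, opposite signs. -/
theorem sum_powerset_neg_one_pow_sdiff_erase {M : Type*} [AddCommGroup M] [Module ℂ M]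
    {i : ℤ} (hi : i ∈ A) (f : Finset ℤ → M) (hf : ∀ C, f C = f (C.erase i)) :
    ∑ C ∈ A.powerset, (-1 : ℂ) ^ (A \ C).card • f C = 0 := by
  obtain ⟨A', hA', rfl⟩ : ∃ A', i ∉ A' ∧ insert i A' = A :=
    ⟨A.erase i, Finset.notMem_erase i A, Finset.insert_erase hi⟩
  rw [Finset.sum_powerset_insert hA', ← Finset.sum_add_distrib]
  refine Finset.sum_eq_zero fun C hC => ?_
  have hiC : i ∉ C := fun h => hA' (Finset.mem_powerset.1 hC h)
  rw [hf (insert i C), Finset.erase_insert hiC, Finset.insert_sdiff_of_notMem _ hiC,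
    Finset.card_insert_of_notMem (fun h => hA' (Finset.mem_sdiff.1 h).1),
    Finset.insert_sdiff_insert, Finset.sdiff_insert_of_notMem hA', pow_succ]
  simp

/-- Möbius inversion on the Boolean lattice. Pairing `A` with `insert i A` cancels every `C` without
`i`; the rest is the induction hypothesis for `C ↦ f (insert i C)`. -/
theorem sum_powerset_sum_powerset_neg_one_pow_sdiff {M : Type*} [AddCommGroup M] [Module ℂ M]
    (B : Finset ℤ) (f : Finset ℤ → M) :
    ∑ A ∈ B.powerset, ∑ C ∈ A.powerset, (-1 : ℂ) ^ (A \ C).card • f C = f B := by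
  induction B using Finset.induction_on generalizing f with
  | empty => simp
  | insert i B hi ih =>
    rw [Finset.sum_powerset_insert hi, ← Finset.sum_add_distrib, ← ih fun C => f (insert i C)]
    refine Finset.sum_congr rfl fun A hA => ?_
    have hiA : i ∉ A := fun h => hi (Finset.mem_powerset.1 hA h)
    rw [Finset.sum_powerset_insert hiA, ← add_assoc, ← Finset.sum_add_distrib]
    have h0 : ∑ C ∈ A.powerset, ((-1 : ℂ) ^ (A \ C).card • f C +
        (-1 : ℂ) ^ (insert i A \ C).card • f C) = 0 := by
      refine Finset.sum_eq_zero fun C hC => ?_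
      have hiC : i ∉ C := fun h => hiA (Finset.mem_powerset.1 hC h)
      rw [Finset.insert_sdiff_of_notMem _ hiC,
        Finset.card_insert_of_notMem (fun h => hiA (Finset.mem_sdiff.1 h).1), pow_succ]
      simp
    rw [h0, zero_add]
    refine Finset.sum_congr rfl fun C _ => ?_
    rw [Finset.insert_sdiff_insert, Finset.sdiff_insert_of_notMem hiA]

theorem isTracelessOp_of_partialTrace_erase [NeZero d] {X : Op d A}
    (h : ∀ i : A, (partialTrace X : Op d (A.erase (i : ℤ))) = 0) : IsTracelessOp X := by
  intro i s t
  have hd : (d : ℂ) ≠ 0 := Nat.cast_ne_zero.2 (NeZero.ne d)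
  -- The embedded partial trace is diagonal at `i`, so `t` is changed to agree with `s` there; the
  -- single-site sum overwrites that value anyway.
  have := embed_partialTrace_erase i X s (Function.update t i (s i))
  rw [h i, embed_zero, if_pos (by simp)] at this
  simpa [hd] using this.symm

theorem IsTracelessOp.partialTrace_erase [NeZero d] {X : Op d A} (hX : IsTracelessOp X) (i : A) :
    (partialTrace X : Op d (A.erase (i : ℤ))) = 0 := by
  apply embed_injective (A.erase_subset (i : ℤ))
  ext s t
  rw [embed_partialTrace_erase, embed_zero, hX i s t]
  simp

theorem IsTracelessOp.add {X Y : Op d A} (hX : IsTracelessOp X) (hY : IsTracelessOp Y) :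
    IsTracelessOp (X + Y) := fun i s t => by
  simp only [Matrix.add_apply, Finset.sum_add_distrib, hX i s t, hY i s t, add_zero]

theorem IsTracelessOp.smul {X : Op d A} (hX : IsTracelessOp X) (c : ℂ) :
    IsTracelessOp (c • X) := fun i s t => by
  simp only [Matrix.smul_apply, ← Finset.smul_sum, hX i s t, smul_zero]

theorem IsTracelessOp.conjTranspose {X : Op d A} (hX : IsTracelessOp X) :
    IsTracelessOp X.conjTranspose := fun i s t => by
  have := congrArg star (hX i t s)
  rwa [star_sum, star_zero] at this

variable [NeZero d]

theorem partialTrace_embed_erase (h : A ⊆ B) (i : A) (X : Op d A) :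
    (partialTrace (embed h X) : Op d (B.erase (i : ℤ))) =
      embed (Finset.erase_subset_erase (i : ℤ) h) (partialTrace X) := by
  apply embed_injective (B.erase_subset (i : ℤ))
  rw [embed_embed, ← embed_embed (A.erase_subset (i : ℤ)) h]
  ext s t
  have hres : ∀ (s : B → Fin d) (k : Fin d),
      res h (Function.update s ⟨i, h i.2⟩ k) = Function.update (res h s) i k := by
    intro s k
    funext j
    by_cases hj : j = i
    · subst hj; simp [res]
    · have : (⟨j, h j.2⟩ : B) ≠ ⟨i, h i.2⟩ := fun h' => hj (Subtype.ext (by simpa using h'))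
      simp [res, hj, this]
  rw [embed_partialTrace_erase (⟨i, h i.2⟩ : B), embed_apply, embed_partialTrace_erase]
  simp only [embed_apply, hres]
  have hiff : ∀ k, (∀ j : B, (j : ℤ) ∉ A →
      Function.update s ⟨i, h i.2⟩ k j = Function.update t ⟨i, h i.2⟩ k j) ↔
      ∀ j : B, (j : ℤ) ∉ A → s j = t j := by
    intro k
    refine forall_congr' fun j => forall_congr' fun hj => ?_
    have : j ≠ (⟨i, h i.2⟩ : B) := by rintro rfl; exact hj i.2
    simp [this]
  simp only [hiff]
  split_ifs <;> simp

theorem IsTracelessOp.partialTrace_embed_eq_zero {X : Op d A} (hX : IsTracelessOp X)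
    (h : A ⊆ B) (hC : C ⊆ B) (hAC : ¬ A ⊆ C) : (partialTrace (embed h X) : Op d C) = 0 := by
  obtain ⟨i, hi, hiC⟩ := Finset.not_subset.1 hAC
  have hC' : C ⊆ B.erase i := Finset.subset_erase.2 ⟨hC, hiC⟩
  rw [← partialTrace_partialTrace hC' (B.erase_subset i), partialTrace_embed_erase h ⟨i, hi⟩,
    hX.partialTrace_erase ⟨i, hi⟩, embed_zero, ← zero_smul ℂ (0 : Op d (B.erase i)),
    partialTrace_smul, zero_smul]

/-- Tracing out `i` sends the `C`-term to one that depends only on `C.erase i`, so the alternating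
sum cancels in pairs. -/
theorem component_isTracelessOp (h : A ⊆ B) (Y : Op d B) : IsTracelessOp (component A Y) := by
  refine isTracelessOp_of_partialTrace_erase fun i => ?_
  have key : ∀ C ∈ A.powerset,
      (partialTrace (emb A (partialTrace Y : Op d C)) : Op d (A.erase (i : ℤ))) =
        emb (A.erase (i : ℤ)) (partialTrace Y : Op d (C.erase (i : ℤ))) := by
    intro C hC
    rw [Finset.mem_powerset] at hC
    rw [emb_of_subset hC, emb_of_subset (Finset.erase_subset_erase _ hC)]
    by_cases hi : (i : ℤ) ∈ C
    · rw [partialTrace_embed_erase hC ⟨i, hi⟩,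
        partialTrace_partialTrace (Finset.erase_subset _ _) (hC.trans h)]
    · have hC' : C ⊆ A.erase (i : ℤ) := Finset.subset_erase.2 ⟨hC, hi⟩
      have hiC : C.erase (i : ℤ) = C := Finset.erase_eq_of_notMem hi
      rw [← embed_embed hC' (Finset.erase_subset _ _), partialTrace_embed, ← emb_of_subset hC',
        ← emb_of_subset]
      exact emb_partialTrace_congr hiC.symm Y
  have hsum : (partialTrace (component A Y) : Op d (A.erase (i : ℤ))) =
      ∑ C ∈ A.powerset, (-1 : ℂ) ^ (A \ C).card •
        (partialTrace (emb A (partialTrace Y : Op d C)) : Op d (A.erase (i : ℤ))) := by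
    rw [component_eq_sum]
    exact (map_sum (partialTraceLin d _ _) _ _).trans
      (Finset.sum_congr rfl fun C _ => map_smul (partialTraceLin d _ _) _ _)
  rw [hsum, ← sum_powerset_neg_one_pow_sdiff_erase i.2
    (fun C => emb (A.erase (i : ℤ)) (partialTrace Y : Op d (C.erase (i : ℤ))))
    (fun C => emb_partialTrace_congr Finset.erase_idem.symm Y)]
  exact Finset.sum_congr rfl fun C hC => by rw [key C hC]

theorem sum_emb_component (Y : Op d B) : ∑ A ∈ B.powerset, emb B (component A Y) = Y := by
  have := sum_powerset_sum_powerset_neg_one_pow_sdiff B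
    (fun C => emb B (partialTrace Y : Op d C))
  rw [emb_of_subset subset_rfl, embed_self, partialTrace_self] at this
  refine Eq.trans (Finset.sum_congr rfl fun A hA => ?_) this
  rw [component_eq_sum, emb_sum]
  refine Finset.sum_congr rfl fun C hC => ?_
  rw [emb_smul, emb_emb (Finset.mem_powerset.1 hC) (Finset.mem_powerset.1 hA)]

theorem component_partialTrace (hA : A ⊆ T) (h : T ⊆ B) (Y : Op d B) :
    component A (partialTrace Y : Op d T) = component A Y := by
  rw [component_eq_sum, component_eq_sum]
  refine Finset.sum_congr rfl fun D hD => ?_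
  rw [partialTrace_partialTrace ((Finset.mem_powerset.1 hD).trans hA) h]

theorem component_mul_comm_of_disjoint (hA : A ⊆ B) (hS : S ⊆ B) (h : Disjoint S A) (X : Op d S)
    (Y : Op d B) : component A (embed hS X * Y) = component A (Y * embed hS X) := by
  rw [component_eq_sum, component_eq_sum]
  refine Finset.sum_congr rfl fun D hD => ?_
  have hDA := Finset.mem_powerset.1 hD
  rw [partialTrace_mul_comm hS (hDA.trans hA) (Finset.disjoint_of_subset_right hDA h)]

theorem IsTracelessOp.component_embed_self {X : Op d A} (hX : IsTracelessOp X) (h : A ⊆ B) :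
    component A (embed h X) = X := by
  rw [component_eq_sum, Finset.sum_eq_single A]
  · rw [partialTrace_embed, emb_of_subset subset_rfl, embed_self]
    simp
  · intro C hC hCA
    have hC' := Finset.mem_powerset.1 hC
    rw [hX.partialTrace_embed_eq_zero h (hC'.trans h), emb_zero, smul_zero]
    exact fun h' => hCA (Finset.Subset.antisymm hC' h')
  · intro h'; exact absurd (Finset.mem_powerset_self A) h'

/-- If `C ⊄ A`, every partial trace in the component kills `X`. Otherwise some `i ∈ A` lies outside
`C`; the condition `C ⊆ D` does not see `i`, and the alternating sum cancels. -/
theorem IsTracelessOp.component_embed_of_ne {X : Op d C} (hX : IsTracelessOp X) (h : C ⊆ B)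
    (hA : A ⊆ B) (hne : A ≠ C) : component A (embed h X) = 0 := by
  rw [component_eq_sum]
  by_cases hCA : C ⊆ A
  · obtain ⟨i, hi, hiC⟩ : ∃ i ∈ A, i ∉ C := by
      by_contra! h'
      exact hne (Finset.Subset.antisymm h' hCA)
    have key : ∀ D ∈ A.powerset, emb A (partialTrace (embed h X) : Op d D) =
        if C ⊆ D then emb A X else 0 := by
      intro D hD
      have hDA := Finset.mem_powerset.1 hD
      split_ifs with hCD
      · rw [← embed_embed hCD (hDA.trans hA), partialTrace_embed, ← emb_of_subset hCD,
          emb_emb hCD hDA]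
      · rw [hX.partialTrace_embed_eq_zero h (hDA.trans hA) hCD, emb_zero]
    rw [Finset.sum_congr rfl fun D hD => by rw [key D hD]]
    refine sum_powerset_neg_one_pow_sdiff_erase hi (fun D => if C ⊆ D then emb A X else 0)
      fun D => ?_
    simp only [Finset.subset_erase, hiC, not_false_eq_true, and_true]
  · refine Finset.sum_eq_zero fun D hD => ?_
    have hDA := Finset.mem_powerset.1 hD
    rw [hX.partialTrace_embed_eq_zero h (hDA.trans hA) fun h' => hCA (h'.trans hDA), emb_zero,
      smul_zero]

theorem component_embed_of_not_subset (h : S ⊆ B) (hA : A ⊆ B) (hAS : ¬ A ⊆ S) (X : Op d S) :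
    component A (embed h X) = 0 := by
  rw [← sum_emb_component X, embed_sum, component_sum]
  refine Finset.sum_eq_zero fun C hC => ?_
  have hCS := Finset.mem_powerset.1 hC
  rw [emb_of_subset hCS, embed_embed]
  refine (component_isTracelessOp hCS X).component_embed_of_ne _ hA ?_
  rintro rfl
  exact hAS hCS

/-- One of the two supports has a site outside the other, and tracing over it gives zero. -/
theorem IsTracelessOp.ntr_mul_eq_zero {X : Op d A} {Y : Op d C} (hX : IsTracelessOp X)
    (hY : IsTracelessOp Y) (hA : A ⊆ B) (hC : C ⊆ B) (hne : A ≠ C) :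
    ntr (embed hA X * embed hC Y) = 0 := by
  by_cases h : A ⊆ C
  · have h' : ¬ C ⊆ A := fun h' => hne (Finset.Subset.antisymm h h')
    rw [ntr_embed_mul, hY.partialTrace_embed_eq_zero hC hA h', mul_zero, ntr_zero]
  · rw [ntr_mul_comm, ntr_embed_mul, hX.partialTrace_embed_eq_zero hA hC h, mul_zero, ntr_zero]

theorem IsTracelessOp.ntr_embed_mul {X : Op d A} (hX : IsTracelessOp X) (hA : A ⊆ B)
    (Y : Op d B) : ntr (embed hA X * Y) = ntr (X * component A Y) := by
  conv_lhs => rw [← sum_emb_component Y]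
  rw [Finset.mul_sum, ntr_sum, Finset.sum_eq_single A]
  · rw [emb_of_subset hA, ← embed_mul, ntr_embed]
  · intro C hC hne
    rw [emb_of_subset (Finset.mem_powerset.1 hC)]
    exact hX.ntr_mul_eq_zero (component_isTracelessOp (Finset.mem_powerset.1 hC) Y) _ _ hne.symm
  · intro h; exact absurd (Finset.mem_powerset.2 hA) h

end SpinChain

namespace SpinChain

variable {d : ℕ} {A B C S T : Finset ℤ} {Φ Ψ Ω : FormalOp d} {r r₁ r₂ r₃ : ℕ}

/-! ### Local formal operators and their commutators -/

/-- The commutator of two operators. -/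
def br (X Y : Op d B) : Op d B := X * Y - Y * X

theorem add_br (X Y Z : Op d B) : br (X + Y) Z = br X Z + br Y Z := by
  simp only [br, add_mul, mul_add]; abel

theorem br_add (X Y Z : Op d B) : br X (Y + Z) = br X Y + br X Z := by
  simp only [br, add_mul, mul_add]; abel

theorem zero_br (X : Op d B) : br 0 X = 0 := by simp [br]

theorem br_zero (X : Op d B) : br X 0 = 0 := by simp [br]

theorem br_skew (X Y : Op d B) : -br Y X = br X Y := by simp [br]

theorem br_br (X Y Z : Op d B) : br X (br Y Z) = br (br X Y) Z + br Y (br X Z) := by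
  simp only [br]; noncomm_ring

theorem sum_br {ι : Type*} (s : Finset ι) (f : ι → Op d B) (Y : Op d B) :
    br (∑ i ∈ s, f i) Y = ∑ i ∈ s, br (f i) Y := by
  simp only [br, Finset.sum_mul, Finset.mul_sum, Finset.sum_sub_distrib]

theorem br_sum {ι : Type*} (s : Finset ι) (f : ι → Op d B) (Y : Op d B) :
    br Y (∑ i ∈ s, f i) = ∑ i ∈ s, br Y (f i) := by
  simp only [br, Finset.sum_mul, Finset.mul_sum, Finset.sum_sub_distrib]

/-- `Φ` is traceless and at most `r`-local. -/
structure IsLoc (r : ℕ) (Φ : FormalOp d) : Prop where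
  traceless : IsTraceless Φ
  range : ∀ A, Φ A ≠ 0 → ∀ i ∈ A, ∀ j ∈ A, j - i < r

theorem setRange_le_iff : setRange A ≤ r ↔ ∀ i ∈ A, ∀ j ∈ A, j - i < r := by
  rw [setRange]
  split_ifs with h
  · rw [Int.toNat_le]
    constructor
    · intro h' i hi j hj
      have := A.min'_le i hi
      have := A.le_max' j hj
      omega
    · intro h'
      have := h' _ (A.min'_mem h) _ (A.max'_mem h)
      omega
  · rw [Finset.not_nonempty_iff_eq_empty] at h
    simp [h]

theorem opRange_le_iff :
    opRange Φ ≤ r ↔ ∀ A, Φ A ≠ 0 → ∀ i ∈ A, ∀ j ∈ A, j - i < r := by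
  simp only [opRange, iSup₂_le_iff, Nat.cast_le, setRange_le_iff]

theorem IsLoc.opRange_le (h : IsLoc r Φ) : opRange Φ ≤ r := opRange_le_iff.2 h.range

theorem IsLoc.mono (h : IsLoc r₁ Φ) (hr : r₁ ≤ r₂) : IsLoc r₂ Φ :=
  ⟨h.traceless, fun A hA i hi j hj => by have := h.range A hA i hi j hj; omega⟩

theorem IsTraceless.add (hΦ : IsTraceless Φ) (hΨ : IsTraceless Ψ) : IsTraceless (Φ + Ψ) :=
  fun A => (hΦ A).add (hΨ A)

theorem IsLoc.add (hΦ : IsLoc r Φ) (hΨ : IsLoc r Ψ) : IsLoc r (Φ + Ψ) where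
  traceless := hΦ.traceless.add hΨ.traceless
  range A hA := by
    by_cases h : Φ A = 0
    · refine hΨ.range A fun h' => hA ?_
      simp [h, h']
    · exact hΦ.range A h

theorem mem_thicken {x : ℤ} : x ∈ thicken r A ↔ ∃ i ∈ A, i - r ≤ x ∧ x ≤ i + r := by
  simp [thicken]

theorem subset_thicken : A ⊆ thicken r A := fun x hx => mem_thicken.2 ⟨x, hx, by omega, by omega⟩

theorem thicken_mono (h : r₁ ≤ r₂) : thicken r₁ A ⊆ thicken r₂ A := fun x hx => by
  obtain ⟨i, hi, h1, h2⟩ := mem_thicken.1 hx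
  exact mem_thicken.2 ⟨i, hi, by omega, by omega⟩

theorem restrictTo_eq_sum (Φ : FormalOp d) (B : Finset ℤ) :
    restrictTo Φ B = ∑ A ∈ B.powerset, emb B (Φ A) := by
  rw [restrictTo, ← Finset.sum_attach B.powerset]
  exact Finset.sum_congr rfl fun A _ => (emb_of_subset (Finset.mem_powerset.1 A.2) _).symm

theorem restrictTo_add (Φ Ψ : FormalOp d) :
    restrictTo (Φ + Ψ) B = restrictTo Φ B + restrictTo Ψ B := by
  simp only [restrictTo_eq_sum, Pi.add_apply, emb_add, Finset.sum_add_distrib]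

theorem restrictTo_zero : restrictTo (0 : FormalOp d) B = 0 := by
  simp [restrictTo_eq_sum, emb_zero]

theorem comm_zero_left : comm (0 : FormalOp d) Ψ = 0 := by
  funext A
  simp [comm, restrictTo_zero, component_zero]

theorem comm_zero_right : comm Φ (0 : FormalOp d) = 0 := by
  funext A
  simp [comm, restrictTo_zero, component_zero]

variable [NeZero d]

/-- Terms inside `T` are unchanged, and any other term is traced over one of its own sites. This
consistency lets the region in `comm` vary. -/
theorem partialTrace_restrictTo (hΦ : IsTraceless Φ) (h : T ⊆ B) :
    (partialTrace (restrictTo Φ B) : Op d T) = restrictTo Φ T := by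
  rw [restrictTo_eq_sum, restrictTo_eq_sum]
  refine (map_sum (partialTraceLin d T B) _ _).trans ?_
  symm
  refine Eq.trans (Finset.sum_congr rfl fun C hC => ?_)
    (Finset.sum_subset (Finset.powerset_mono.2 h) fun C hC hCT => ?_)
  · have hC' := Finset.mem_powerset.1 hC
    change _ = partialTrace _
    rw [emb_of_subset hC', emb_of_subset (hC'.trans h), ← embed_embed hC' h, partialTrace_embed]
  · have hC' := Finset.mem_powerset.1 hC
    change partialTrace _ = _
    rw [emb_of_subset hC']
    exact (hΦ C).partialTrace_embed_eq_zero hC' h fun h' => hCT (Finset.mem_powerset.2 h')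

theorem component_restrictTo (hΦ : IsTraceless Φ) (h : A ⊆ B) :
    component A (restrictTo Φ B) = Φ A := by
  rw [restrictTo_eq_sum, component_sum, Finset.sum_eq_single A]
  · rw [emb_of_subset h, (hΦ A).component_embed_self]
  · intro C hC hne
    rw [emb_of_subset (Finset.mem_powerset.1 hC)]
    exact (hΦ C).component_embed_of_ne _ h hne.symm
  · intro h'; exact absurd (Finset.mem_powerset.2 h) h'

theorem component_br_of_disjoint (hA : A ⊆ B) (h : Disjoint S A) (X : Op d S) (Y : Op d B) :
    component A (br (emb B X) Y) = 0 := by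
  rw [emb]
  split_ifs with hS
  · rw [br, component_sub, component_mul_comm_of_disjoint hA hS h, sub_self]
  · rw [zero_br, component_zero]

/-- Only those `Φ(C)` with `C` meeting `A` contribute, and these live in `T = thicken _ A`. The
operator `Φ|_T` can be pulled out of the partial trace onto `T`, which turns `Ψ|_B` into `Ψ|_T`. -/
theorem comm_eq_of_opRange (hr : opRange Φ ≠ ⊤) (hΨ : IsTraceless Ψ)
    (hB : thicken (opRange Φ).toNat A ⊆ B) :
    comm Φ Ψ A = component A (br (restrictTo Φ B) (restrictTo Ψ B)) := by
  set T := thicken (opRange Φ).toNat A with hT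
  have hAT : A ⊆ T := subset_thicken
  have hrange := opRange_le_iff.1 (ENat.natCast_toNat hr).ge
  have hsplit : component A (br (restrictTo Φ B) (restrictTo Ψ B)) =
      component A (br (embed hB (restrictTo Φ T)) (restrictTo Ψ B)) := by
    rw [restrictTo_eq_sum Φ B, restrictTo_eq_sum Φ T, embed_sum, sum_br,
      sum_br, component_sum, component_sum]
    symm
    refine Eq.trans (Finset.sum_congr rfl fun C hC => ?_)
      (Finset.sum_subset (Finset.powerset_mono.2 hB) fun C hC hCT => ?_)
    · rw [← emb_of_subset, emb_emb (Finset.mem_powerset.1 hC) hB]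
    · by_cases hC0 : Φ C = 0
      · rw [hC0, emb_zero, zero_br, component_zero]
      · refine component_br_of_disjoint (hAT.trans hB) ?_ _ _
        by_contra hdis
        refine hCT (Finset.mem_powerset.2 fun x hx => ?_)
        obtain ⟨i, hiC, hiA⟩ := Finset.not_disjoint_iff.1 hdis
        have h1 := hrange C hC0 i hiC x hx
        have h2 := hrange C hC0 x hx i hiC
        exact mem_thicken.2 ⟨i, hiA, by omega, by omega⟩
  rw [hsplit, ← component_partialTrace hAT hB, br]
  have : (partialTrace (embed hB (restrictTo Φ T) * restrictTo Ψ B -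
      restrictTo Ψ B * embed hB (restrictTo Φ T)) : Op d T) =
      restrictTo Φ T * restrictTo Ψ T - restrictTo Ψ T * restrictTo Φ T := by
    refine (map_sub (partialTraceLin d T B) _ _).trans ?_
    change partialTrace _ - partialTrace _ = _
    rw [partialTrace_embed_mul, partialTrace_mul_embed, partialTrace_restrictTo hΨ hB]
  rw [this, comm]

/-- Any upper bound `r` on the range suffices. For parameter families this gives a region that is
fixed even if `opRange` jumps. -/
theorem comm_eq (hΦ : IsLoc r Φ) (hΨ : IsTraceless Ψ) (hB : thicken r A ⊆ B) :
    comm Φ Ψ A = component A (br (restrictTo Φ B) (restrictTo Ψ B)) := by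
  have hr : opRange Φ ≠ ⊤ := ne_top_of_le_ne_top (ENat.natCast_ne_top r) hΦ.opRange_le
  refine comm_eq_of_opRange hr hΨ ((thicken_mono ?_).trans hB)
  exact ENat.toNat_le_of_le_natCast hΦ.opRange_le

/-- A contributing pair `C`, `E` must overlap and cover `A`, so the range of `A` is at most `r₁ + r₂
- 1`. -/
theorem range_of_component_br_ne_zero (hΦ : IsLoc r₁ Φ) (hΨ : IsLoc r₂ Ψ) (hA : A ⊆ B)
    (h : component A (br (restrictTo Φ B) (restrictTo Ψ B)) ≠ 0) :
    ∀ i ∈ A, ∀ j ∈ A, j - i + 1 < r₁ + r₂ := by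
  rw [restrictTo_eq_sum, restrictTo_eq_sum, sum_br, component_sum] at h
  obtain ⟨C, hC, h⟩ := Finset.exists_ne_zero_of_sum_ne_zero h
  rw [br_sum, component_sum] at h
  obtain ⟨E, hE, h⟩ := Finset.exists_ne_zero_of_sum_ne_zero h
  rw [Finset.mem_powerset] at hC hE
  rw [emb_of_subset hC, emb_of_subset hE] at h
  have hC0 : Φ C ≠ 0 := fun h0 => h (by rw [h0, embed_zero, zero_br, component_zero])
  have hE0 : Ψ E ≠ 0 := fun h0 => h (by rw [h0, embed_zero, br_zero, component_zero])
  have hCE : ¬ Disjoint C E := fun hdis =>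
    h (by rw [br, embed_commute hC hE hdis, sub_self, component_zero])
  have hsub : A ⊆ C ∪ E := by
    by_contra hsub
    apply h
    rw [← embed_embed Finset.subset_union_left (Finset.union_subset hC hE),
      ← embed_embed Finset.subset_union_right (Finset.union_subset hC hE), br,
      ← embed_mul, ← embed_mul, ← embed_sub]
    exact component_embed_of_not_subset _ hA hsub _
  obtain ⟨x, hxC, hxE⟩ := Finset.not_disjoint_iff.1 hCE
  have hCr := hΦ.range C hC0
  have hEr := hΨ.range E hE0
  intro i hi j hj
  rcases Finset.mem_union.1 (hsub hi) with hi | hi <;>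
    rcases Finset.mem_union.1 (hsub hj) with hj | hj
  · have := hCr i hi j hj
    -- Used only for `0 < r₂`.
    have := hEr x hxE x hxE
    omega
  · have := hCr i hi x hxC
    have := hEr x hxE j hj
    omega
  · have := hCr x hxC j hj
    have := hEr i hi x hxE
    omega
  · have := hCr x hxC x hxC
    have := hEr i hi j hj
    omega

theorem comm_isTraceless (Φ Ψ : FormalOp d) : IsTraceless (comm Φ Ψ) := fun _ =>
  component_isTracelessOp subset_thicken _

theorem IsLoc.comm (hΦ : IsLoc r₁ Φ) (hΨ : IsLoc r₂ Ψ) (hr : r₁ + r₂ ≤ r + 1) :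
    IsLoc r (comm Φ Ψ) where
  traceless := comm_isTraceless Φ Ψ
  range A hA i hi j hj := by
    rw [comm_eq hΦ hΨ.traceless subset_rfl] at hA
    have := range_of_component_br_ne_zero hΦ hΨ subset_thicken hA i hi j hj
    omega

theorem comm_self (hΦ : IsLoc r Φ) : comm Φ Φ = 0 := by
  funext A
  rw [comm_eq hΦ hΦ.traceless subset_rfl, br, sub_self, component_zero, Pi.zero_apply]

theorem comm_swap (hΦ : IsLoc r₁ Φ) (hΨ : IsLoc r₂ Ψ) : comm Ψ Φ = -comm Φ Ψ := by
  funext A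
  rw [Pi.neg_apply, comm_eq hΦ hΨ.traceless (thicken_mono (Nat.le_add_right r₁ r₂)),
    comm_eq hΨ hΦ.traceless (thicken_mono (Nat.le_add_left r₂ r₁)), ← component_neg, br_skew]

theorem comm_add_right (hΦ : IsLoc r Φ) (hΨ : IsTraceless Ψ) (hΩ : IsTraceless Ω) :
    comm Φ (Ψ + Ω) = comm Φ Ψ + comm Φ Ω := by
  funext A
  rw [Pi.add_apply, comm_eq hΦ (hΨ.add hΩ) subset_rfl, comm_eq hΦ hΨ subset_rfl,
    comm_eq hΦ hΩ subset_rfl, restrictTo_add, br_add, component_add]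

theorem comm_add_left (hΦ : IsLoc r Φ) (hΨ : IsLoc r Ψ) (hΩ : IsTraceless Ω) :
    comm (Φ + Ψ) Ω = comm Φ Ω + comm Ψ Ω := by
  funext A
  rw [Pi.add_apply, comm_eq (hΦ.add hΨ) hΩ subset_rfl, comm_eq hΦ hΩ subset_rfl,
    comm_eq hΨ hΩ subset_rfl, restrictTo_add, add_br, component_add]

/-- Expand the inner bracket in components on `E`. Those with `E` disjoint from `A` drop out, and
those of range above `r₁ + r₂` vanish. The others lie within `r₁ + r₂` of `A`, and a further margin
`r₁` identifies them with `comm Φ Ψ E`; hence the radius `2 * (r₁ + r₂)`. -/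
theorem comm_comm_eq (hΦ : IsLoc r₁ Φ) (hΨ : IsLoc r₂ Ψ) (hΩ : IsTraceless Ω)
    (hB : thicken (2 * (r₁ + r₂)) A ⊆ B) :
    comm (comm Φ Ψ) Ω A =
      component A (br ((br (restrictTo Φ B) (restrictTo Ψ B))) (restrictTo Ω B)) := by
  have hloc := hΦ.comm hΨ (Nat.le_succ (r₁ + r₂))
  have hAB : A ⊆ B := subset_thicken.trans hB
  rw [comm_eq hloc hΩ ((thicken_mono (by omega)).trans hB), restrictTo_eq_sum (comm Φ Ψ)]
  conv_rhs => rw [← sum_emb_component (br (restrictTo Φ B) (restrictTo Ψ B))]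
  rw [sum_br, sum_br, component_sum, component_sum]
  refine Finset.sum_congr rfl fun E hE => ?_
  by_cases hdis : Disjoint E A
  · rw [component_br_of_disjoint hAB hdis, component_br_of_disjoint hAB hdis]
  by_cases hrange : ∀ i ∈ E, ∀ j ∈ E, j - i < r₁ + r₂
  · rw [comm_eq hΦ hΨ.traceless]
    refine Finset.Subset.trans (fun x hx => ?_) hB
    obtain ⟨i, hi, h1, h2⟩ := mem_thicken.1 hx
    obtain ⟨j, hjE, hjA⟩ := Finset.not_disjoint_iff.1 hdis
    have := hrange i hi j hjE
    have := hrange j hjE i hi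
    exact mem_thicken.2 ⟨j, hjA, by push_cast; omega, by push_cast; omega⟩
  · have h1 : comm Φ Ψ E = 0 := by
      by_contra h0
      exact hrange fun i hi j hj => by
        have := hloc.range E h0 i hi j hj
        omega
    have h2 : component E (br (restrictTo Φ B) (restrictTo Ψ B)) = 0 := by
      by_contra h0
      exact hrange fun i hi j hj => by
        have := range_of_component_br_ne_zero hΦ hΨ (Finset.mem_powerset.1 hE) h0 i hi j hj
        omega
    rw [h1, h2]

theorem comm_jacobi (hΦ : IsLoc r₁ Φ) (hΨ : IsLoc r₂ Ψ) (hΩ : IsLoc r₃ Ω) :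
    comm Φ (comm Ψ Ω) = comm (comm Φ Ψ) Ω + comm Ψ (comm Φ Ω) := by
  -- The swaps put every nested commutator on the left, the form `comm_comm_eq` evaluates.
  rw [comm_swap (hΨ.comm hΩ (Nat.le_succ _)) hΦ, comm_swap (hΦ.comm hΩ (Nat.le_succ _)) hΨ]
  funext A
  have hB : ∀ {m}, m ≤ r₁ + r₂ + r₃ → thicken (2 * m) A ⊆ thicken (2 * (r₁ + r₂ + r₃)) A :=
    fun h => thicken_mono (by omega)
  rw [Pi.add_apply, Pi.neg_apply, Pi.neg_apply, comm_comm_eq hΦ hΨ hΩ.traceless (hB (by omega)),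
    comm_comm_eq hΨ hΩ hΦ.traceless (hB (by omega)),
    comm_comm_eq hΦ hΩ hΨ.traceless (hB (by omega)), ← component_neg, ← component_neg,
    ← component_add, br_skew, br_skew, br_br]

end SpinChain

namespace SpinChain

variable {d : ℕ} {A B C E S T W : Finset ℤ} {Φ Ψ : FormalOp d} {r r₁ r₂ : ℕ}

/-! ### Translations -/

/-- The translate `A + k`. -/
def shiftBy (k : ℤ) (A : Finset ℤ) : Finset ℤ := A.map (addRightEmbedding k)

theorem mem_shiftBy {k x : ℤ} : x ∈ shiftBy k A ↔ x - k ∈ A := by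
  simp only [shiftBy, Finset.mem_map, addRightEmbedding_apply]
  exact ⟨by rintro ⟨a, ha, rfl⟩; simpa using ha, fun h => ⟨_, h, sub_add_cancel _ _⟩⟩

theorem mem_shift {x : ℤ} : x ∈ shift A ↔ x - 1 ∈ A := mem_shiftBy

theorem shiftBy_shiftBy (k l : ℤ) : shiftBy k (shiftBy l A) = shiftBy (l + k) A := by
  ext x
  rw [mem_shiftBy, mem_shiftBy, mem_shiftBy, sub_sub, add_comm]

theorem shiftBy_zero : shiftBy 0 A = A := by
  ext x
  rw [mem_shiftBy, sub_zero]

theorem shift_shiftBy (k : ℤ) : shift (shiftBy k A) = shiftBy (k + 1) A := shiftBy_shiftBy 1 k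

theorem shift_subset_shift (h : A ⊆ B) : shift A ⊆ shift B := Finset.map_subset_map.2 h

theorem shift_injective : Function.Injective shift := Finset.map_injective _

theorem shift_union : shift (A ∪ B) = shift A ∪ shift B := Finset.map_union _ _

/-- Translation of configurations as an equivalence. -/
def shiftConfigEquiv (d : ℕ) (A : Finset ℤ) : (A → Fin d) ≃ (shift A → Fin d) where
  toFun := shiftConfig
  invFun s i := s ⟨i + 1, mem_shift.2 (by simp)⟩
  left_inv s := by funext i; simp [shiftConfig]
  right_inv s := by funext i; simp [shiftConfig]

/-- The translate by `-1` of an operator on `A + 1`. -/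
def unshift (X : Op d (shift A)) : Op d A := X.submatrix shiftConfig shiftConfig

theorem translate_apply (Φ : FormalOp d) (A : Finset ℤ) :
    translate Φ A = unshift (Φ (shift A)) := rfl

theorem IsTranslationInvariant.unshift_eq (h : IsTranslationInvariant Φ) (A : Finset ℤ) :
    unshift (Φ (shift A)) = Φ A := congrFun h A

theorem unshift_mul (X Y : Op d (shift A)) : unshift (X * Y) = unshift X * unshift Y :=
  (Matrix.submatrix_mul_equiv X Y shiftConfig (shiftConfigEquiv d A) shiftConfig).symm

theorem unshift_sub (X Y : Op d (shift A)) : unshift (X - Y) = unshift X - unshift Y := rfl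

theorem unshift_zero : unshift (0 : Op d (shift A)) = 0 := rfl

theorem unshift_sum {ι : Type*} (s : Finset ι) (f : ι → Op d (shift A)) :
    unshift (∑ i ∈ s, f i) = ∑ i ∈ s, unshift (f i) := by
  ext a b
  simp [unshift, Matrix.sum_apply]

theorem unshift_br (X Y : Op d (shift A)) : unshift (br X Y) = br (unshift X) (unshift Y) := by
  rw [br, unshift_sub, unshift_mul, unshift_mul, br]

theorem unshift_conjTranspose (X : Op d (shift A)) :
    unshift X.conjTranspose = (unshift X).conjTranspose := rfl

theorem unshift_eq_zero_iff {X : Op d (shift A)} : unshift X = 0 ↔ X = 0 := by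
  refine ⟨fun h => ?_, fun h => by rw [h, unshift_zero]⟩
  ext s t
  have := congrFun (congrFun h ((shiftConfigEquiv d A).symm s)) ((shiftConfigEquiv d A).symm t)
  rw [← (shiftConfigEquiv d A).apply_symm_apply s, ← (shiftConfigEquiv d A).apply_symm_apply t]
  exact this

theorem ntr_unshift (X : Op d (shift A)) : ntr (unshift X) = ntr X := by
  have hcard : (shift A).card = A.card := Finset.card_map _
  rw [ntr, ntr, hcard]
  congr 1
  exact (shiftConfigEquiv d A).sum_comp fun s => X s s

theorem unshift_embed (h : A ⊆ B) (X : Op d (shift A)) :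
    unshift (embed (shift_subset_shift h) X) = embed h (unshift X) := by
  ext s t
  rw [unshift, Matrix.submatrix_apply, embed_apply, embed_apply]
  refine if_congr ⟨fun H i hi => ?_, fun H i hi => ?_⟩ rfl rfl
  · have := H ⟨i + 1, mem_shift.2 (by simp)⟩ (fun h' => hi (by simpa using mem_shift.1 h'))
    simpa [shiftConfig] using this
  · exact H ⟨(i : ℤ) - 1, sub_one_mem i⟩ fun h' => hi (mem_shift.2 h')

theorem unshift_emb (X : Op d (shift A)) :
    unshift (emb (shift B) X) = emb B (unshift X) := by
  by_cases h : A ⊆ B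
  · rw [emb_of_subset (shift_subset_shift h), emb_of_subset h, unshift_embed]
  · rw [emb, emb, dif_neg h, dif_neg, unshift_zero]
    exact fun h' => h (Finset.map_subset_map.1 h')

theorem IsTracelessOp.unshift {X : Op d (shift A)} (hX : IsTracelessOp X) :
    IsTracelessOp (unshift X) := by
  intro i s t
  have key : ∀ (s : A → Fin d) (k : Fin d), shiftConfig (Function.update s i k) =
      Function.update (shiftConfig s) ⟨i + 1, mem_shift.2 (by simp)⟩ k := by
    intro s k
    funext j
    by_cases hj : (j : ℤ) = i + 1
    · obtain rfl : j = ⟨i + 1, mem_shift.2 (by simp)⟩ := Subtype.ext hj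
      simp [shiftConfig]
    · have h1 : j ≠ ⟨i + 1, mem_shift.2 (by simp)⟩ := fun h => hj (congrArg Subtype.val h)
      have h2 : (⟨(j : ℤ) - 1, sub_one_mem j⟩ : A) ≠ i := fun h => hj (by
        have := congrArg Subtype.val h
        simp only at this
        omega)
      simp [shiftConfig, h1, h2]
  simpa only [SpinChain.unshift, Matrix.submatrix_apply, key] using hX _ _ _

theorem IsTraceless.translate (h : IsTraceless Φ) : IsTraceless (translate Φ) :=
  fun A => (h (shift A)).unshift

theorem IsLoc.translate (h : IsLoc r Φ) : IsLoc r (translate Φ) where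
  traceless := h.traceless.translate
  range A hA i hi j hj := by
    have hA' : Φ (shift A) ≠ 0 := fun h0 => hA (by rw [translate_apply, h0, unshift_zero])
    have := h.range _ hA' (i + 1) (mem_shift.2 (by simpa using hi)) (j + 1)
      (mem_shift.2 (by simpa using hj))
    omega

theorem unshift_restrictTo (Φ : FormalOp d) (B : Finset ℤ) :
    unshift (restrictTo Φ (shift B)) = restrictTo (translate Φ) B := by
  rw [restrictTo_eq_sum, restrictTo_eq_sum, unshift_sum]
  symm
  refine Finset.sum_bij (fun A _ => shift A) ?_ (fun A _ C _ h => shift_injective h) ?_ ?_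
  · intro A hA
    exact Finset.mem_powerset.2 (shift_subset_shift (Finset.mem_powerset.1 hA))
  · intro C hC
    have hCs : shift (shiftBy (-1) C) = C := by
      rw [shift_shiftBy, neg_add_cancel, shiftBy_zero]
    refine ⟨shiftBy (-1) C, Finset.mem_powerset.2 ?_, hCs⟩
    rw [← Finset.map_subset_map (f := addRightEmbedding (1 : ℤ))]
    change shift _ ⊆ shift B
    rw [hCs]
    exact Finset.mem_powerset.1 hC
  · intro A _
    rw [unshift_emb, translate_apply]

theorem unshift_component [NeZero d] (h : A ⊆ B) (Y : Op d (shift B)) :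
    unshift (component (shift A) Y) = component A (unshift Y) := by
  -- The components of `Y` form a formal operator whose restriction is `Y`, so the claim reduces to
  -- `unshift_restrictTo`.
  let F : FormalOp d := fun E => if E ⊆ shift B then component E Y else 0
  have hF : IsTraceless F := by
    intro E
    by_cases hE : E ⊆ shift B
    · simpa only [F, if_pos hE] using component_isTracelessOp hE Y
    · simp only [F, if_neg hE]
      intro i s t
      simp
  have hY : restrictTo F (shift B) = Y := by
    rw [restrictTo_eq_sum]
    conv_rhs => rw [← sum_emb_component Y]
    refine Finset.sum_congr rfl fun E hE => ?_
    simp only [F, if_pos (Finset.mem_powerset.1 hE)]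
  rw [← hY, unshift_restrictTo, component_restrictTo hF.translate h,
    component_restrictTo hF (shift_subset_shift h), translate_apply]

theorem translate_comm [NeZero d] (hΦ : IsLoc r Φ) (hΨ : IsTraceless Ψ) :
    translate (comm Φ Ψ) = comm (translate Φ) (translate Ψ) := by
  funext A
  rw [comm_eq hΦ.translate hΨ.translate subset_rfl, translate_apply,
    comm_eq hΦ hΨ (B := shift (thicken r A)), unshift_component subset_thicken, unshift_br,
    unshift_restrictTo, unshift_restrictTo]
  intro x hx
  obtain ⟨i, hi, h1, h2⟩ := mem_thicken.1 hx
  exact mem_shift.2 (mem_thicken.2 ⟨i - 1, mem_shift.1 hi, by omega, by omega⟩)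

theorem IsTranslationInvariant.comm [NeZero d] (hΦ : IsTranslationInvariant Φ)
    (hΨ : IsTranslationInvariant Ψ) (hΦl : IsLoc r Φ) (hΨl : IsTraceless Ψ) :
    IsTranslationInvariant (comm Φ Ψ) := by
  rw [IsTranslationInvariant, translate_comm hΦl hΨl, hΦ, hΨ]

theorem translate_add (Φ Ψ : FormalOp d) : translate (Φ + Ψ) = translate Φ + translate Ψ := rfl

theorem IsTranslationInvariant.shiftBy_eq_zero_iff (hΦ : IsTranslationInvariant Φ) (k : ℤ)
    (A : Finset ℤ) : Φ (shiftBy k A) = 0 ↔ Φ A = 0 := by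
  have step : ∀ A, Φ (shift A) = 0 ↔ Φ A = 0 := fun A => by
    rw [← hΦ.unshift_eq A, unshift_eq_zero_iff]
  induction k using Int.induction_on with
  | zero => rw [shiftBy_zero]
  | succ k ih => exact (shift_shiftBy (A := A) _ ▸ step _).trans ih
  | pred k ih =>
    have := step (shiftBy (-k - 1) A)
    rw [shift_shiftBy, sub_add_cancel] at this
    exact this.symm.trans ih

theorem leftmost_mem (h : A.Nonempty) : leftmost A ∈ A := by
  rw [leftmost, dif_pos h]; exact A.min'_mem h

theorem leftmost_le {x : ℤ} (hx : x ∈ A) : leftmost A ≤ x := by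
  rw [leftmost, dif_pos ⟨x, hx⟩]; exact A.min'_le x hx

theorem leftmost_shiftBy (h : A.Nonempty) (k : ℤ) : leftmost (shiftBy k A) = leftmost A + k := by
  have h1 : leftmost A + k ∈ shiftBy k A := mem_shiftBy.2 (by simpa using leftmost_mem h)
  refine le_antisymm (leftmost_le h1) ?_
  have h2 := leftmost_le (mem_shiftBy.1 (leftmost_mem ⟨_, h1⟩))
  omega

end SpinChain

namespace SpinChain

variable {d : ℕ} {A B C E S T W : Finset ℤ} {H K Q Φ Ψ : FormalOp d} {r r₁ r₂ : ℕ}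

/-! ### The trace per site -/

theorem emb_conjTranspose (X : Op d A) : emb B X.conjTranspose = (emb B X).conjTranspose := by
  rw [emb, emb]
  split_ifs with h
  · exact embed_conjTranspose h X
  · simp

theorem ntr_conjTranspose (X : Op d B) : ntr X.conjTranspose = star (ntr X) := by
  rw [ntr, ntr, Matrix.trace_conjTranspose, star_mul']
  simp

theorem br_conjTranspose (X Y : Op d B) :
    (br X Y).conjTranspose = br Y.conjTranspose X.conjTranspose := by
  simp [br]

theorem ntr_mul_br (X Y Z : Op d B) : ntr (X * br Y Z) = ntr (br X Y * Z) := by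
  rw [br, br, mul_sub, sub_mul, ntr_sub, ntr_sub, ← mul_assoc, ← mul_assoc,
    ntr_mul_comm (X * Z) Y, ← mul_assoc]

/-- The trace form `tr (K(A)† [H(E), Q(C)])`, computed in the region `W`. -/
noncomputable def triTrace (K H Q : FormalOp d) (W : Finset ℤ)
    (x : Finset ℤ × Finset ℤ × Finset ℤ) : ℂ :=
  ntr ((emb W (K x.1)).conjTranspose * br (emb W (H x.2.1)) (emb W (Q x.2.2)))

/-- The trace form `tr (K(A)† [H(E), Q(C)])`, computed in the region `A ∪ E ∪ C`. -/
noncomputable def triForm (K H Q : FormalOp d) (x : Finset ℤ × Finset ℤ × Finset ℤ) : ℂ :=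
  triTrace K H Q (x.1 ∪ x.2.1 ∪ x.2.2) x

/-- Translation of triples of regions. -/
def shiftTriple (k : ℤ) (x : Finset ℤ × Finset ℤ × Finset ℤ) : Finset ℤ × Finset ℤ × Finset ℤ :=
  (shiftBy k x.1, shiftBy k x.2.1, shiftBy k x.2.2)

theorem shiftTriple_zero (x) : shiftTriple 0 x = x := by simp [shiftTriple, shiftBy_zero]

theorem shiftTriple_shiftTriple (k l : ℤ) (x) :
    shiftTriple k (shiftTriple l x) = shiftTriple (l + k) x := by
  simp [shiftTriple, shiftBy_shiftBy]

theorem triForm_shiftTriple_one (hK : IsTranslationInvariant K) (hH : IsTranslationInvariant H)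
    (hQ : IsTranslationInvariant Q) (x) :
    triForm K H Q (shiftTriple 1 x) = triForm K H Q x := by
  have hW : (shiftTriple 1 x).1 ∪ (shiftTriple 1 x).2.1 ∪ (shiftTriple 1 x).2.2 =
      shift (x.1 ∪ x.2.1 ∪ x.2.2) := by
    rw [shift_union, shift_union]; rfl
  rw [triForm, hW, triTrace]
  change ntr ((emb _ (K (shift x.1))).conjTranspose *
    br (emb _ (H (shift x.2.1))) (emb _ (Q (shift x.2.2)))) = _
  rw [← ntr_unshift, unshift_mul, unshift_conjTranspose, unshift_br, unshift_emb, unshift_emb,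
    unshift_emb, hK.unshift_eq, hH.unshift_eq, hQ.unshift_eq, triForm, triTrace]

theorem triForm_shiftTriple (hK : IsTranslationInvariant K) (hH : IsTranslationInvariant H)
    (hQ : IsTranslationInvariant Q) (k : ℤ) (x) :
    triForm K H Q (shiftTriple k x) = triForm K H Q x := by
  induction k using Int.induction_on with
  | zero => rw [shiftTriple_zero]
  | succ k ih => rw [← ih, ← triForm_shiftTriple_one hK hH hQ (shiftTriple k x),
      shiftTriple_shiftTriple]
  | pred k ih => rw [← ih, ← triForm_shiftTriple_one hK hH hQ (shiftTriple (-k - 1) x),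
      shiftTriple_shiftTriple, sub_add_cancel]

/-- By cyclicity the bracket can be moved to `[K(A)†, H(E)]`, so `E` must meet `A` as well as `C`.
-/
theorem disjoint_of_triForm_ne_zero {x} (h : triForm K H Q x ≠ 0) :
    (K x.1 ≠ 0 ∧ H x.2.1 ≠ 0 ∧ Q x.2.2 ≠ 0) ∧ ¬ Disjoint x.1 x.2.1 ∧ ¬ Disjoint x.2.1 x.2.2 := by
  obtain ⟨A, E, C⟩ := x
  rw [triForm, triTrace] at h
  have hA : A ⊆ A ∪ E ∪ C := Finset.subset_union_left.trans Finset.subset_union_left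
  have hE : E ⊆ A ∪ E ∪ C := Finset.subset_union_right.trans Finset.subset_union_left
  have hC : C ⊆ A ∪ E ∪ C := Finset.subset_union_right
  refine ⟨⟨?_, ?_, ?_⟩, ?_, ?_⟩
  · intro h0; exact h (by simp only [h0, emb_zero, Matrix.conjTranspose_zero, zero_mul, ntr_zero])
  · intro h0; exact h (by simp only [h0, emb_zero, zero_br, mul_zero, ntr_zero])
  · intro h0; exact h (by simp only [h0, emb_zero, br_zero, mul_zero, ntr_zero])
  · intro hdis
    apply h
    simp only at hdis ⊢
    rw [← emb_conjTranspose, ntr_mul_br, emb_of_subset hA, emb_of_subset hE, br,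
      embed_commute hA hE hdis, sub_self, zero_mul, ntr_zero]
  · intro hdis
    apply h
    simp only at hdis ⊢
    rw [emb_of_subset hE, emb_of_subset hC, br, embed_commute hE hC hdis, sub_self, mul_zero,
      ntr_zero]

/-- `A`, `E`, `C` form a chain of overlapping sets, each of range at most `r`, with one end rooted
at `0`. -/
theorem subset_Icc_of_triForm_ne_zero (hK : IsLoc r K) (hH : IsLoc r H) (hQ : IsLoc r Q) {x}
    (h : triForm K H Q x ≠ 0) (h0 : leftmost x.1 = 0 ∨ leftmost x.2.2 = 0) :
    x.1 ⊆ Finset.Icc (-(3 * r : ℤ)) (3 * r) ∧ x.2.1 ⊆ Finset.Icc (-(3 * r : ℤ)) (3 * r) ∧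
      x.2.2 ⊆ Finset.Icc (-(3 * r : ℤ)) (3 * r) := by
  obtain ⟨A, E, C⟩ := x
  obtain ⟨⟨hA, hE, hC⟩, hAE, hEC⟩ := disjoint_of_triForm_ne_zero h
  simp only at *
  obtain ⟨a, haA, haE⟩ := Finset.not_disjoint_iff.1 hAE
  obtain ⟨c, hcE, hcC⟩ := Finset.not_disjoint_iff.1 hEC
  have hK' := hK.range A hA
  have hH' := hH.range E hE
  have hQ' := hQ.range C hC
  have hac := hH' a haE c hcE
  have hca := hH' c hcE a haE
  have hlA := leftmost_mem ⟨a, haA⟩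
  have hlC := leftmost_mem ⟨c, hcC⟩
  have e1 := hK' _ hlA _ haA
  have e2 := hQ' _ hlC _ hcC
  have e3 := leftmost_le haA
  have e4 := leftmost_le hcC
  refine ⟨fun x hx => ?_, fun x hx => ?_, fun x hx => ?_⟩ <;> rw [Finset.mem_Icc]
  · have f1 := hK' x hx a haA
    have f2 := hK' a haA x hx
    omega
  · have f1 := hH' x hx a haE
    have f2 := hH' a haE x hx
    have f3 := hH' x hx c hcE
    have f4 := hH' c hcE x hx
    omega
  · have f1 := hQ' x hx c hcC
    have f2 := hQ' c hcC x hx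
    omega

/-- The nonempty subsets of `W` with leftmost site `0`. -/
def rootedSubsets (W : Finset ℤ) : Finset (Finset ℤ) :=
  W.powerset.filter fun A => A.Nonempty ∧ leftmost A = 0

theorem mem_rootedSubsets : A ∈ rootedSubsets W ↔ A ⊆ W ∧ A.Nonempty ∧ leftmost A = 0 := by
  rw [rootedSubsets, Finset.mem_filter, Finset.mem_powerset]

theorem eq_of_shiftTriple_eq {k l : ℤ} {x y} (h : shiftTriple k x = shiftTriple l y)
    (hkl : k = l) : x = y := by
  have := congrArg (shiftTriple (-k)) h
  rwa [shiftTriple_shiftTriple, shiftTriple_shiftTriple, ← hkl, add_neg_cancel, shiftTriple_zero,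
    shiftTriple_zero] at this

/-- Mass transport: a translation-invariant sum over triples rooted in the first region equals
the sum over triples rooted in the last one. -/
theorem sum_triForm_rooted (hK : IsLoc r K) (hH : IsLoc r H) (hQ : IsLoc r Q)
    (hKi : IsTranslationInvariant K) (hHi : IsTranslationInvariant H)
    (hQi : IsTranslationInvariant Q) (hW : W = Finset.Icc (-(3 * r : ℤ)) (3 * r)) :
    ∑ x ∈ rootedSubsets W ×ˢ W.powerset ×ˢ W.powerset, triForm K H Q x =
      ∑ x ∈ W.powerset ×ˢ W.powerset ×ˢ rootedSubsets W, triForm K H Q x := by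
  have hne : ∀ {x}, triForm K H Q x ≠ 0 → x.1.Nonempty ∧ x.2.2.Nonempty := by
    intro x hx
    obtain ⟨-, h1, h2⟩ := disjoint_of_triForm_ne_zero hx
    obtain ⟨a, ha, -⟩ := Finset.not_disjoint_iff.1 h1
    obtain ⟨c, -, hc⟩ := Finset.not_disjoint_iff.1 h2
    exact ⟨⟨a, ha⟩, ⟨c, hc⟩⟩
  have hsub : ∀ {x}, triForm K H Q x ≠ 0 → (leftmost x.1 = 0 ∨ leftmost x.2.2 = 0) →
      x.1 ⊆ W ∧ x.2.1 ⊆ W ∧ x.2.2 ⊆ W := by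
    rw [hW]
    exact subset_Icc_of_triForm_ne_zero hK hH hQ
  have hinv := triForm_shiftTriple hKi hHi hQi
  -- Each triple is translated until its last region is rooted at `0`. The shift can be recovered
  -- because the first region was rooted at `0`.
  refine Finset.sum_bij_ne_zero (fun x _ _ => shiftTriple (-leftmost x.2.2) x) ?_ ?_ ?_ ?_
  · intro x hx h0
    have h0' : triForm K H Q (shiftTriple (-leftmost x.2.2) x) ≠ 0 := by rwa [hinv]
    have hl : leftmost (shiftTriple (-leftmost x.2.2) x).2.2 = 0 :=
      (leftmost_shiftBy (hne h0).2 _).trans (add_neg_cancel _)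
    obtain ⟨s1, s2, s3⟩ := hsub h0' (Or.inr hl)
    simp only [Finset.mem_product, Finset.mem_powerset, mem_rootedSubsets]
    exact ⟨s1, s2, s3, (hne h0').2, hl⟩
  · intro x hx h0 y hy h0' hxy
    refine eq_of_shiftTriple_eq hxy ?_
    have hx' := (mem_rootedSubsets.1 (Finset.mem_product.1 hx).1).2
    have hy' := (mem_rootedSubsets.1 (Finset.mem_product.1 hy).1).2
    have := congrArg (fun z => leftmost z.1) hxy
    simp only [shiftTriple] at this
    rwa [leftmost_shiftBy hx'.1, leftmost_shiftBy hy'.1, hx'.2, hy'.2, zero_add, zero_add] at this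
  · intro y hy h0
    have hy' := (mem_rootedSubsets.1 (Finset.mem_product.1 (Finset.mem_product.1 hy).2).2).2
    have h0' : triForm K H Q (shiftTriple (-leftmost y.1) y) ≠ 0 := by rwa [hinv]
    have hl : leftmost (shiftTriple (-leftmost y.1) y).1 = 0 :=
      (leftmost_shiftBy (hne h0).1 _).trans (add_neg_cancel _)
    obtain ⟨s1, s2, s3⟩ := hsub h0' (Or.inl hl)
    refine ⟨shiftTriple (-leftmost y.1) y, ?_, h0', ?_⟩
    · simp only [Finset.mem_product, Finset.mem_powerset, mem_rootedSubsets]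
      exact ⟨⟨s1, (hne h0').1, hl⟩, s2, s3⟩
    · have : leftmost (shiftTriple (-leftmost y.1) y).2.2 = -leftmost y.1 := by
        refine (leftmost_shiftBy (hne h0).2 _).trans ?_
        rw [hy'.2, zero_add]
      rw [this, shiftTriple_shiftTriple, neg_neg, neg_add_cancel, shiftTriple_zero]
  · intro x _ _
    rw [hinv]

theorem rootedSubsets_subset : rootedSubsets W ⊆ W.powerset := Finset.filter_subset _ _

open scoped ComplexOrder in
theorem ntr_conjTranspose_mul_self_nonneg (X : Op d B) : 0 ≤ ntr (X.conjTranspose * X) := by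
  have h1 : ((d : ℂ) ^ B.card)⁻¹ = (((d : ℝ) ^ B.card)⁻¹ : ℝ) := by push_cast; rfl
  rw [ntr, h1]
  refine mul_nonneg (Complex.zero_le_real.2 (by positivity)) ?_
  exact (Matrix.posSemidef_conjTranspose_mul_self X).trace_nonneg

variable [NeZero d]

theorem triForm_eq_triTrace {x} (h1 : x.1 ⊆ W) (h2 : x.2.1 ⊆ W) (h3 : x.2.2 ⊆ W) :
    triForm K H Q x = triTrace K H Q W x := by
  have hW : x.1 ∪ x.2.1 ∪ x.2.2 ⊆ W := Finset.union_subset (Finset.union_subset h1 h2) h3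
  have e1 : x.1 ⊆ x.1 ∪ x.2.1 ∪ x.2.2 :=
    Finset.subset_union_left.trans Finset.subset_union_left
  have e2 : x.2.1 ⊆ x.1 ∪ x.2.1 ∪ x.2.2 :=
    Finset.subset_union_right.trans Finset.subset_union_left
  have e3 : x.2.2 ⊆ x.1 ∪ x.2.1 ∪ x.2.2 := Finset.subset_union_right
  rw [triTrace, ← emb_emb e1 hW, ← emb_emb e2 hW, ← emb_emb e3 hW, emb_of_subset hW,
    emb_of_subset hW, emb_of_subset hW, br, ← embed_conjTranspose, ← embed_mul, ← embed_mul,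
    ← embed_sub, ← embed_mul, ntr_embed, triForm, triTrace, br]

theorem sum_triForm_left (S : Finset (Finset ℤ)) (hS : S ⊆ W.powerset) (hK : IsTraceless K) :
    ∑ x ∈ S ×ˢ W.powerset ×ˢ W.powerset, triForm K H Q x =
      ∑ A ∈ S, ntr ((K A).conjTranspose *
        component A (br (restrictTo H W) (restrictTo Q W))) := by
  rw [Finset.sum_product]
  refine Finset.sum_congr rfl fun A hA => ?_
  have hAW := Finset.mem_powerset.1 (hS hA)
  rw [← (hK A).conjTranspose.ntr_embed_mul hAW, restrictTo_eq_sum, restrictTo_eq_sum, sum_br,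
    Finset.mul_sum, ntr_sum, Finset.sum_product]
  refine Finset.sum_congr rfl fun E hE => ?_
  rw [br_sum, Finset.mul_sum, ntr_sum]
  refine Finset.sum_congr rfl fun C hC => ?_
  rw [triForm_eq_triTrace hAW (Finset.mem_powerset.1 hE) (Finset.mem_powerset.1 hC), triTrace,
    ← emb_conjTranspose, emb_of_subset hAW]

/-- For Hermitian `H`, `tr (K†[H, Q])` is the conjugate of `tr (Q†[H, K])`: this is the symmetry of
`ad H`. -/
theorem sum_triForm_right (S : Finset (Finset ℤ)) (hS : S ⊆ W.powerset) (hQ : IsTraceless Q)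
    (hH : IsSelfAdj H) :
    ∑ x ∈ W.powerset ×ˢ W.powerset ×ˢ S, triForm K H Q x =
      ∑ C ∈ S, star (ntr ((Q C).conjTranspose *
        component C (br (restrictTo H W) (restrictTo K W)))) := by
  simp only [Finset.sum_product]
  rw [Finset.sum_comm' (t' := W.powerset) (s' := fun _ => W.powerset) (by tauto)]
  rw [Finset.sum_congr rfl fun E _ => Finset.sum_comm, Finset.sum_comm]
  refine Finset.sum_congr rfl fun C hC => ?_
  have hCW := Finset.mem_powerset.1 (hS hC)
  rw [← (hQ C).conjTranspose.ntr_embed_mul hCW, restrictTo_eq_sum, restrictTo_eq_sum, sum_br,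
    Finset.mul_sum, ntr_sum, star_sum]
  refine Finset.sum_congr rfl fun E hE => ?_
  rw [br_sum, Finset.mul_sum, ntr_sum, star_sum]
  refine Finset.sum_congr rfl fun A hA => ?_
  rw [triForm_eq_triTrace (Finset.mem_powerset.1 hA) (Finset.mem_powerset.1 hE) hCW, triTrace,
    ← ntr_conjTranspose, Matrix.conjTranspose_mul, br_conjTranspose, embed_conjTranspose,
    Matrix.conjTranspose_conjTranspose, ← emb_conjTranspose (H E), (hH E).eq, ntr_mul_br,
    emb_of_subset hCW]

open scoped ComplexOrder in
theorem eq_zero_of_ntr_conjTranspose_mul_self {X : Op d B}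
    (h : ntr (X.conjTranspose * X) = 0) : X = 0 := by
  have hd : (d : ℂ) ≠ 0 := Nat.cast_ne_zero.2 (NeZero.ne d)
  rw [ntr, mul_eq_zero, or_iff_right (inv_ne_zero (pow_ne_zero _ hd))] at h
  exact Matrix.trace_conjTranspose_mul_self_eq_zero_iff.1 h

theorem comm_empty (hΦ : IsLoc r Φ) (hΨ : IsTraceless Ψ) : comm Φ Ψ ∅ = 0 := by
  rw [comm_eq hΦ hΨ subset_rfl, ← embed_self subset_rfl (restrictTo Φ _), ← emb_of_subset]
  exact component_br_of_disjoint (Finset.empty_subset _) (Finset.disjoint_empty_right _) _ _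

/-- The commutator with a self-adjoint translation-invariant local operator is symmetric for the
trace per site, so its kernel on translation-invariant local operators is that of its square. -/
theorem comm_eq_zero_of_comm_comm_eq_zero (hH : IsLoc r₁ H) (hHi : IsTranslationInvariant H)
    (hHs : IsSelfAdj H) (hQ : IsLoc r₂ Q) (hQi : IsTranslationInvariant Q)
    (h : comm H (comm H Q) = 0) : comm H Q = 0 := by
  set K := comm H Q with hKdef
  obtain ⟨r, hr⟩ : ∃ r, r = r₁ + r₂ := ⟨_, rfl⟩
  have hK : IsLoc r K := hH.comm hQ (by omega)
  replace hH : IsLoc r H := hH.mono (by omega)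
  replace hQ : IsLoc r Q := hQ.mono (by omega)
  have hKi : IsTranslationInvariant K := hHi.comm hQi hH hQ.traceless
  obtain ⟨W, hW⟩ : ∃ W, W = Finset.Icc (-(3 * r : ℤ)) (3 * r) := ⟨_, rfl⟩
  have hrooted : ∀ {Φ : FormalOp d}, IsLoc r Φ → ∀ A, A.Nonempty → leftmost A = 0 → Φ A ≠ 0 →
      thicken r A ⊆ W := by
    intro Φ hΦ A hA hA0 hΦA x hx
    obtain ⟨i, hi, h1, h2⟩ := mem_thicken.1 hx
    have e1 := leftmost_le hi
    have e2 := hΦ.range A hΦA _ (leftmost_mem hA) i hi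
    rw [hW, Finset.mem_Icc]
    omega
  -- The sum rooted at `A` is `⟨K, [H, Q]⟩ = ⟨K, K⟩`; rooted at `C` it is the conjugate of `⟨Q, [H,
  -- K]⟩`, which vanishes by `h`.
  have hleft : ∑ A ∈ rootedSubsets W, ntr ((K A).conjTranspose * K A) = 0 := by
    have key := sum_triForm_rooted hK hH hQ hKi hHi hQi hW
    rw [sum_triForm_left _ rootedSubsets_subset hK.traceless,
      sum_triForm_right _ rootedSubsets_subset hQ.traceless hHs] at key
    refine Eq.trans (Finset.sum_congr rfl fun A hA => ?_) (key.trans ?_)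
    · by_cases hA0 : K A = 0
      · rw [hA0, Matrix.conjTranspose_zero, zero_mul, zero_mul]
      · obtain ⟨-, h1, h2⟩ := mem_rootedSubsets.1 hA
        rw [← comm_eq hH hQ.traceless (hrooted hK A h1 h2 hA0)]
    · refine Finset.sum_eq_zero fun C hC => ?_
      by_cases hC0 : Q C = 0
      · rw [hC0, Matrix.conjTranspose_zero, zero_mul, ntr_zero, star_zero]
      · obtain ⟨-, h1, h2⟩ := mem_rootedSubsets.1 hC
        rw [← comm_eq hH hK.traceless (hrooted hQ C h1 h2 hC0), h, Pi.zero_apply, mul_zero,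
          ntr_zero, star_zero]
  open scoped ComplexOrder in
  rw [Finset.sum_eq_zero_iff_of_nonneg fun A _ => ntr_conjTranspose_mul_self_nonneg (K A)] at hleft
  funext A
  -- The rooted sum does not see the component at `∅`, which vanishes for any commutator. Every
  -- nonempty `A` is a translate of a rooted set.
  rcases A.eq_empty_or_nonempty with rfl | hA
  · exact comm_empty hH hQ.traceless
  · by_contra hne
    have hne' : K (shiftBy (-leftmost A) A) ≠ 0 :=
      fun h0 => hne ((hKi.shiftBy_eq_zero_iff _ A).1 h0)
    have hl : leftmost (shiftBy (-leftmost A) A) = 0 :=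
      (leftmost_shiftBy hA _).trans (add_neg_cancel _)
    have hne2 : (shiftBy (-leftmost A) A).Nonempty := hA.map
    refine hne' (eq_zero_of_ntr_conjTranspose_mul_self (hleft _ (mem_rootedSubsets.2 ⟨?_, hne2, hl⟩)))
    exact subset_thicken.trans (hrooted hK _ hne2 hl hne')

end SpinChain

namespace SpinChain

variable {d D : ℕ} {A B : Finset ℤ} {r r₁ r₂ : ℕ}

/-! ### Dependence on parameters -/

/-- Entries of `L X` are fixed linear combinations of entries of `X`, so entrywise derivatives and
smoothness pass through `L`. -/
theorem linearMap_apply_eq_sum (L : Op d B →ₗ[ℂ] Op d A) (X : Op d B) (s t : A → Fin d) :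
    L X s t = ∑ a, ∑ b, X a b * L (Matrix.single a b 1) s t := by
  conv_lhs => rw [Matrix.matrix_eq_sum_single X]
  simp only [map_sum, Matrix.sum_apply]
  refine Finset.sum_congr rfl fun a _ => Finset.sum_congr rfl fun b _ => ?_
  rw [← mul_one (X a b), ← smul_eq_mul (X a b), ← Matrix.smul_single, map_smul]
  simp

/-- `emb B` as a linear map. -/
noncomputable def embLin (d : ℕ) (A B : Finset ℤ) : Op d A →ₗ[ℂ] Op d B where
  toFun := emb B
  map_add' := emb_add
  map_smul' := emb_smul

/-- All entries of `f` have the entries of `f'` as their derivatives at `0`. -/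
def HasEntryDeriv (f : ℝ → Op d A) (f' : Op d A) : Prop :=
  ∀ s t, HasDerivAt (fun τ => f τ s t) (f' s t) 0

theorem HasEntryDeriv.linear {f : ℝ → Op d B} {f' : Op d B} (h : HasEntryDeriv f f')
    (L : Op d B →ₗ[ℂ] Op d A) : HasEntryDeriv (fun τ => L (f τ)) (L f') := fun s t => by
  rw [funext fun τ => linearMap_apply_eq_sum L (f τ) s t, linearMap_apply_eq_sum L f']
  exact HasDerivAt.fun_sum fun a _ => HasDerivAt.fun_sum fun b _ => (h a b).mul_const _

theorem HasEntryDeriv.sum {ι : Type*} {S : Finset ι} {f : ι → ℝ → Op d A} {f' : ι → Op d A}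
    (h : ∀ i ∈ S, HasEntryDeriv (f i) (f' i)) :
    HasEntryDeriv (fun τ => ∑ i ∈ S, f i τ) (∑ i ∈ S, f' i) := fun s t => by
  simp only [Matrix.sum_apply]
  exact HasDerivAt.fun_sum fun i hi => h i hi s t

theorem HasEntryDeriv.mul {f g : ℝ → Op d A} {f' g' : Op d A} (hf : HasEntryDeriv f f')
    (hg : HasEntryDeriv g g') :
    HasEntryDeriv (fun τ => f τ * g τ) (f' * g 0 + f 0 * g') := fun s t => by
  simp only [Matrix.add_apply, Matrix.mul_apply, ← Finset.sum_add_distrib]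
  exact HasDerivAt.fun_sum fun i _ => (hf s i).mul (hg i t)

theorem HasEntryDeriv.br {f g : ℝ → Op d A} {f' g' : Op d A} (hf : HasEntryDeriv f f')
    (hg : HasEntryDeriv g g') :
    HasEntryDeriv (fun τ => br (f τ) (g τ)) (br f' (g 0) + br (f 0) g') := fun s t => by
  have := (hf.mul hg s t).sub (hg.mul hf s t)
  refine this.congr_deriv ?_
  simp only [SpinChain.br, Matrix.add_apply, Matrix.sub_apply]
  ring

theorem HasEntryDeriv.restrictTo {Φ : ℝ → FormalOp d} {Φ' : FormalOp d}
    (h : ∀ A, HasEntryDeriv (fun τ => Φ τ A) (Φ' A)) (B : Finset ℤ) :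
    HasEntryDeriv (fun τ => restrictTo (Φ τ) B) (restrictTo Φ' B) := by
  simp only [restrictTo_eq_sum]
  exact HasEntryDeriv.sum fun A _ => (h A).linear (embLin d A B)

/-- All entries of `f` are smooth on `U`. -/
def IsEntrySmoothOn (U : Set (EuclideanSpace ℝ (Fin D)))
    (f : EuclideanSpace ℝ (Fin D) → Op d A) : Prop :=
  ∀ s t, ContDiffOn ℝ ∞ (fun p => f p s t) U

variable {U : Set (EuclideanSpace ℝ (Fin D))} {p : EuclideanSpace ℝ (Fin D)}
  {v : EuclideanSpace ℝ (Fin D) → EuclideanSpace ℝ (Fin D)}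
  {Φ Ψ H C : EuclideanSpace ℝ (Fin D) → FormalOp d}

theorem IsEntrySmoothOn.linear {f : EuclideanSpace ℝ (Fin D) → Op d B}
    (h : IsEntrySmoothOn U f) (L : Op d B →ₗ[ℂ] Op d A) :
    IsEntrySmoothOn U fun p => L (f p) := fun s t => by
  rw [funext fun p => linearMap_apply_eq_sum L (f p) s t]
  exact ContDiffOn.sum fun a _ => ContDiffOn.sum fun b _ => (h a b).mul contDiffOn_const

theorem IsEntrySmoothOn.mul {f g : EuclideanSpace ℝ (Fin D) → Op d A}
    (hf : IsEntrySmoothOn U f) (hg : IsEntrySmoothOn U g) :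
    IsEntrySmoothOn U fun p => f p * g p := fun s t => by
  simp only [Matrix.mul_apply]
  exact ContDiffOn.sum fun i _ => (hf s i).mul (hg i t)

theorem IsSmoothOn.restrictTo (h : IsSmoothOn U Φ) (B : Finset ℤ) :
    IsEntrySmoothOn U fun p => restrictTo (Φ p) B := fun s t => by
  simp only [restrictTo_eq_sum, Matrix.sum_apply]
  exact ContDiffOn.sum fun A _ => IsEntrySmoothOn.linear (h A) (embLin d A B) s t

theorem IsSmoothOn.add (hΦ : IsSmoothOn U Φ) (hΨ : IsSmoothOn U Ψ) :
    IsSmoothOn U fun p => Φ p + Ψ p := fun A s t => (hΦ A s t).add (hΨ A s t)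

theorem IsSmoothOn.dirDeriv (hU : IsOpen U) (hv : ContDiffOn ℝ ∞ v U) (h : IsSmoothOn U Φ) :
    IsSmoothOn U (SpinChain.dirDeriv v Φ) := fun A s t =>
  ((h A s t).fderiv_of_isOpen hU (m := ∞) (by simp)).clm_apply hv

theorem IsSmoothOn.boost (hH : IsSmoothOn U H) (hC : IsSmoothOn U C) :
    IsSmoothOn U fun p => boost (H p) (C p) := fun A s t =>
  (contDiffOn_const.mul (hH A s t)).add (hC A s t)

theorem dirDeriv_apply (A : Finset ℤ) (s t : A → Fin d) :
    dirDeriv v Φ p A s t = fderiv ℝ (fun q => Φ q A s t) p (v p) := rfl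

theorem IsSmoothOn.hasEntryDeriv (hU : IsOpen U) (hp : p ∈ U) (h : IsSmoothOn U Φ)
    (A : Finset ℤ) :
    HasEntryDeriv (fun τ : ℝ => Φ (p + τ • v p) A) (SpinChain.dirDeriv v Φ p A) := fun s t =>
  (((h A s t).contDiffAt (hU.mem_nhds hp)).differentiableAt
    (by simp)).hasFDerivAt.hasLineDerivAt (v p)

theorem eventually_mem_line (hU : IsOpen U) (hp : p ∈ U) (w : EuclideanSpace ℝ (Fin D)) :
    ∀ᶠ τ : ℝ in nhds 0, p + τ • w ∈ U := by
  have hc : Continuous fun τ : ℝ => p + τ • w := by fun_prop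
  exact hc.continuousAt.eventually_mem (by simpa using hU.mem_nhds hp)

theorem dirDeriv_isTranslationInvariant (hU : IsOpen U) (hp : p ∈ U)
    (h : ∀ q ∈ U, IsTranslationInvariant (Φ q)) : IsTranslationInvariant (dirDeriv v Φ p) := by
  funext A
  ext s t
  change fderiv ℝ (fun q => Φ q (shift A) (shiftConfig s) (shiftConfig t)) p (v p) =
    fderiv ℝ (fun q => Φ q A s t) p (v p)
  rw [Filter.EventuallyEq.fderiv_eq]
  filter_upwards [hU.mem_nhds hp] with q hq
  exact congrFun (congrFun ((h q hq).unshift_eq A) s) t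

/-- Tracelessness and locality are vanishing conditions that hold throughout the open set `U`, so
they can be differentiated. -/
theorem dirDeriv_isLoc (hU : IsOpen U) (hp : p ∈ U) (hs : IsSmoothOn U Φ)
    (h : ∀ q ∈ U, IsLoc r (Φ q)) : IsLoc r (dirDeriv v Φ p) where
  traceless A i s t := by
    have h1 : HasDerivAt (fun τ : ℝ => ∑ k : Fin d, Φ (p + τ • v p) A (Function.update s i k)
        (Function.update t i k)) (∑ k : Fin d, dirDeriv v Φ p A (Function.update s i k)
        (Function.update t i k)) 0 :=
      HasDerivAt.fun_sum fun k _ => hs.hasEntryDeriv hU hp A _ _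
    refine h1.unique ((hasDerivAt_const (0 : ℝ) (0 : ℂ)).congr_of_eventuallyEq ?_)
    filter_upwards [eventually_mem_line hU hp (v p)] with τ hτ
    exact (h _ hτ).traceless A i s t
  range A hA := by
    by_contra hrange
    refine hA ?_
    ext s t
    rw [dirDeriv_apply, Filter.EventuallyEq.fderiv_eq (f := fun _ => (0 : ℂ))]
    · simp
    · filter_upwards [hU.mem_nhds hp] with q hq
      have : Φ q A = 0 := by
        by_contra h0
        exact hrange ((h q hq).range A h0)
      rw [this, Matrix.zero_apply]

/-! ### Boosts -/

theorem IsNearestNeighbor.apply_empty {H : FormalOp d} (h : IsNearestNeighbor H) : H ∅ = 0 := by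
  by_contra h0
  obtain ⟨i, hi | hi⟩ := h ∅ h0
  · exact Finset.singleton_ne_empty i hi.symm
  · exact Finset.insert_ne_empty _ _ hi.symm

theorem IsNearestNeighbor.isLoc {H : FormalOp d} (h : IsNearestNeighbor H)
    (ht : IsTraceless H) : IsLoc 2 H where
  traceless := ht
  range A hA i hi j hj := by
    obtain ⟨k, rfl | rfl⟩ := h A hA
    · simp only [Finset.mem_singleton] at hi hj
      omega
    · simp only [Finset.mem_insert, Finset.mem_singleton] at hi hj
      omega

theorem boost_isLoc {H C : FormalOp d} (hH : IsLoc 2 H) (hC : IsLoc 1 C) :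
    IsLoc 2 (boost H C) where
  traceless A := ((hH.traceless A).smul _).add (hC.traceless A)
  range A hA := by
    by_cases h : H A = 0
    · refine (hC.mono one_le_two).range A fun h' => hA ?_
      simp [boost, h, h']
    · exact hH.range A h

theorem translate_boost {H C : FormalOp d} (hH : IsTranslationInvariant H)
    (hC : IsTranslationInvariant C) (h0 : H ∅ = 0) :
    translate (boost H C) = boost H C + H := by
  funext A
  have e : translate (boost H C) A =
      (leftmost (shift A) : ℂ) • unshift (H (shift A)) + unshift (C (shift A)) := rfl
  rw [e, hH.unshift_eq, hC.unshift_eq, Pi.add_apply, boost]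
  rcases A.eq_empty_or_nonempty with rfl | hA
  -- On `∅` translation does not raise `leftmost`, so the identity requires `H ∅ = 0`.
  · simp [h0]
  · have : leftmost (shift A) = leftmost A + 1 := leftmost_shiftBy hA 1
    rw [this]
    push_cast
    rw [add_smul, one_smul]
    abel

theorem charge_succ {n : ℕ} (hn : 2 ≤ n) :
    charge v H C (n + 1) = fun p =>
      comm (boost (H p) (C p)) (charge v H C n p) + dirDeriv v (charge v H C n) p := by
  obtain ⟨k, rfl⟩ := Nat.exists_eq_add_of_le' hn
  rfl

/-! ### Derivatives of commutators -/

variable [NeZero d]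

theorem IsSmoothOn.comm (hΦ : IsSmoothOn U Φ) (hΨ : IsSmoothOn U Ψ)
    (hΦl : ∀ q ∈ U, IsLoc r (Φ q)) (hΨl : ∀ q ∈ U, IsTraceless (Ψ q)) :
    IsSmoothOn U fun p => comm (Φ p) (Ψ p) := fun A s t => by
  have h1 := (hΦ.restrictTo (thicken r A)).mul (hΨ.restrictTo (thicken r A))
  have h2 := (hΨ.restrictTo (thicken r A)).mul (hΦ.restrictTo (thicken r A))
  have h3 : IsEntrySmoothOn U fun p =>
      br (SpinChain.restrictTo (Φ p) (thicken r A)) (SpinChain.restrictTo (Ψ p) (thicken r A)) :=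
    fun s t => (h1 s t).sub (h2 s t)
  refine (h3.linear (componentLin d A (thicken r A)) s t).congr fun q hq => ?_
  exact congrFun (congrFun (comm_eq (hΦl q hq) (hΨl q hq) subset_rfl) s) t

/-- The uniform bound `r₁` allows one region for all parameters near `p`, where this is the Leibniz
rule for matrices. -/
theorem dirDeriv_comm (hU : IsOpen U) (hp : p ∈ U) (hΦ : IsSmoothOn U Φ) (hΨ : IsSmoothOn U Ψ)
    (hΦl : ∀ q ∈ U, IsLoc r₁ (Φ q)) (hΨl : ∀ q ∈ U, IsLoc r₂ (Ψ q)) :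
    dirDeriv v (fun q => comm (Φ q) (Ψ q)) p =
      comm (dirDeriv v Φ p) (Ψ p) + comm (Φ p) (dirDeriv v Ψ p) := by
  have hs := hΦ.comm hΨ hΦl fun q hq => (hΨl q hq).traceless
  funext A
  ext s t
  have h1 := hs.hasEntryDeriv (v := v) hU hp A s t
  have h2 := (((HasEntryDeriv.restrictTo (hΦ.hasEntryDeriv (v := v) hU hp) (thicken r₁ A)).br
    (HasEntryDeriv.restrictTo (hΨ.hasEntryDeriv (v := v) hU hp) (thicken r₁ A))).linear
      (componentLin d A (thicken r₁ A))) s t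
  refine (h1.unique (h2.congr_of_eventuallyEq ?_)).trans ?_
  · filter_upwards [eventually_mem_line hU hp (v p)] with τ hτ
    rw [comm_eq (hΦl _ hτ) (hΨl _ hτ).traceless subset_rfl]
    rfl
  · rw [Pi.add_apply, comm_eq (dirDeriv_isLoc hU hp hΦ hΦl) (hΨl p hp).traceless subset_rfl,
      comm_eq (hΦl p hp) (dirDeriv_isLoc hU hp hΨ hΨl).traceless subset_rfl, ← component_add]
    simp only [zero_smul, add_zero]
    rfl

/-- The derivation `[b, ·] + v · ∇` maps a vanishing commutator to a vanishing Leibniz sum. -/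
theorem comm_derivation_add_comm_derivation (hU : IsOpen U) (hp : p ∈ U) (hΦ : IsSmoothOn U Φ)
    (hΨ : IsSmoothOn U Ψ) (hΦl : ∀ q ∈ U, IsLoc r₁ (Φ q)) (hΨl : ∀ q ∈ U, IsLoc r₂ (Ψ q))
    {b : FormalOp d} (hb : IsLoc r b) (h : ∀ q ∈ U, comm (Φ q) (Ψ q) = 0) :
    comm (comm b (Φ p) + dirDeriv v Φ p) (Ψ p) + comm (Φ p) (comm b (Ψ p) + dirDeriv v Ψ p) =
      0 := by
  have hd : dirDeriv v (fun q => comm (Φ q) (Ψ q)) p = 0 := by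
    funext A
    ext s t
    rw [dirDeriv_apply, Filter.EventuallyEq.fderiv_eq (f := fun _ => (0 : ℂ))]
    · simp
    · filter_upwards [hU.mem_nhds hp] with q hq
      rw [h q hq]; rfl
  have hj := comm_jacobi hb (hΦl p hp) (hΨl p hp)
  rw [h p hp, comm_zero_right] at hj
  rw [dirDeriv_comm hU hp hΦ hΨ hΦl hΨl] at hd
  rw [comm_add_left (r := r + r₁) (hb.comm (hΦl p hp) (Nat.le_succ _))
      ((dirDeriv_isLoc hU hp hΦ hΦl).mono (Nat.le_add_left _ _)) (hΨl p hp).traceless,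
    comm_add_right (hΦl p hp) (comm_isTraceless _ _) (dirDeriv_isLoc hU hp hΨ hΨl).traceless,
    add_add_add_comm, ← hj, hd, add_zero]

/-! ### The induction step from `Q⁽ⁿ⁾` to `Q⁽ⁿ⁺¹⁾`, and the theorem. -/

/-- Smooth families of local translation-invariant conserved quantities of `H`. -/
structure IsConservedFamily (U : Set (EuclideanSpace ℝ (Fin D)))
    (H : EuclideanSpace ℝ (Fin D) → FormalOp d) (n : ℕ)
    (Q : EuclideanSpace ℝ (Fin D) → FormalOp d) : Prop where
  smooth : IsSmoothOn U Q
  loc : ∀ p ∈ U, IsLoc n (Q p)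
  inv : ∀ p ∈ U, IsTranslationInvariant (Q p)
  conserved : ∀ p ∈ U, comm (H p) (Q p) = 0

theorem IsConservedFamily.succ {Q₃ Q : EuclideanSpace ℝ (Fin D) → FormalOp d} {n : ℕ}
    (hU : IsOpen U) (hv : ContDiffOn ℝ ∞ v U)
    (hH : ∀ p ∈ U, IsLoc 2 (H p)) (hH0 : ∀ p ∈ U, H p ∅ = 0)
    (hHs : ∀ p ∈ U, IsSelfAdj (H p)) (hHi : ∀ p ∈ U, IsTranslationInvariant (H p))
    (hHsm : IsSmoothOn U H)
    (hC : ∀ p ∈ U, IsLoc 1 (C p)) (hCi : ∀ p ∈ U, IsTranslationInvariant (C p))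
    (hCsm : IsSmoothOn U C)
    (hQ₃ : Q₃ = fun p => comm (boost (H p) (C p)) (H p) + dirDeriv v H p)
    (hQ₃c : ∀ p ∈ U, comm (H p) (Q₃ p) = 0) (hQ : IsConservedFamily U H n Q) :
    IsConservedFamily U H (n + 1)
      fun p => comm (boost (H p) (C p)) (Q p) + dirDeriv v Q p := by
  have hb : ∀ p ∈ U, IsLoc 2 (boost (H p) (C p)) := fun p hp => boost_isLoc (hH p hp) (hC p hp)
  have hloc : ∀ p ∈ U, IsLoc (n + 1) (comm (boost (H p) (C p)) (Q p) + dirDeriv v Q p) :=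
    fun p hp => ((hb p hp).comm (hQ.loc p hp) (by omega)).add
      ((dirDeriv_isLoc hU hp hQ.smooth hQ.loc).mono (Nat.le_succ n))
  have hinv : ∀ p ∈ U,
      IsTranslationInvariant (comm (boost (H p) (C p)) (Q p) + dirDeriv v Q p) := by
    intro p hp
    have hQt := (hQ.loc p hp).traceless
    have hQi : translate (Q p) = Q p := hQ.inv p hp
    have hdi : translate (dirDeriv v Q p) = dirDeriv v Q p :=
      dirDeriv_isTranslationInvariant hU hp hQ.inv
    -- Translation adds `H` to the boost, and the extra term `[H, Q]` is zero.
    rw [IsTranslationInvariant, translate_add, translate_comm (hb p hp) hQt, hQi, hdi,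
      translate_boost (hHi p hp) (hCi p hp) (hH0 p hp),
      comm_add_left (hb p hp) (hH p hp) hQt, hQ.conserved p hp, add_zero]
  refine ⟨?_, hloc, hinv, fun p hp => ?_⟩
  · exact ((hHsm.boost hCsm).comm hQ.smooth hb fun p hp => (hQ.loc p hp).traceless).add
      (hQ.smooth.dirDeriv hU hv)
  · have hleib := comm_derivation_add_comm_derivation (v := v) hU hp hHsm hQ.smooth hH hQ.loc
      (hb p hp) hQ.conserved
    have hQ₃l : IsLoc 3 (Q₃ p) := by
      rw [hQ₃]
      exact ((hb p hp).comm (hH p hp) le_rfl).add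
        ((dirDeriv_isLoc hU hp hHsm hH).mono (Nat.le_succ 2))
    have hQ₃p : comm (boost (H p) (C p)) (H p) + dirDeriv v H p = Q₃ p := by rw [hQ₃]
    rw [hQ₃p] at hleib
    refine comm_eq_zero_of_comm_comm_eq_zero (hH p hp) (hHi p hp) (hHs p hp) (hloc p hp)
      (hinv p hp) ?_
    -- Jacobi gives `[H, [Q₃, Q]] = 0`. Commuting `H` with `hleib` then leaves `[H, [H, Q']] = 0`
    -- for the next charge `Q'`.
    have hj := comm_jacobi (hH p hp) hQ₃l (hQ.loc p hp)
    rw [hQ₃c p hp, hQ.conserved p hp, comm_zero_left, comm_zero_right, add_zero] at hj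
    have hadd := comm_add_right (hH p hp) (comm_isTraceless (Q₃ p) (Q p))
      (comm_isTraceless (H p) (comm (boost (H p) (C p)) (Q p) + dirDeriv v Q p))
    rwa [hleib, comm_zero_right, hj, zero_add, eq_comm] at hadd

end SpinChain

theorem theorem3 (d D : ℕ) (hd : 0 < d)
    (U : Set (EuclideanSpace ℝ (Fin D))) (hU : IsOpen U)
    (v : EuclideanSpace ℝ (Fin D) → EuclideanSpace ℝ (Fin D)) (hv : ContDiffOn ℝ ∞ v U)
    (H C : EuclideanSpace ℝ (Fin D) → SpinChain.FormalOp d)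
    -- the Hamiltonians `H(p) = ∑ᵢ h²ᵢ(p) + ∑ᵢ h¹ᵢ(p)`
    (hH_traceless : ∀ p ∈ U, SpinChain.IsTraceless (H p))
    (hH_nn : ∀ p ∈ U, SpinChain.IsNearestNeighbor (H p))
    (hH_sa : ∀ p ∈ U, SpinChain.IsSelfAdj (H p))
    (hH_inv : ∀ p ∈ U, SpinChain.IsTranslationInvariant (H p))
    (hH_smooth : SpinChain.IsSmoothOn U H)
    -- the one-local operators `C(p) = ∑ᵢ cᵢ(p)` in the boost operators
    (hC_traceless : ∀ p ∈ U, SpinChain.IsTraceless (C p))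
    (hC_local : ∀ p ∈ U, SpinChain.opRange (C p) ≤ 1)
    (hC_inv : ∀ p ∈ U, SpinChain.IsTranslationInvariant (C p))
    (hC_smooth : SpinChain.IsSmoothOn U C)
    -- the generalized Reshetikhin condition
    (hQ3 : ∀ p ∈ U, SpinChain.IsConserved (H p) (SpinChain.charge v H C 3 p)) :
    -- the `Q⁽ⁿ⁾` are well-defined smooth families of at most `n`-local formal operators
    (∀ n : ℕ, 2 ≤ n → SpinChain.IsSmoothOn U (SpinChain.charge v H C n) ∧
      ∀ p ∈ U, SpinChain.IsTraceless (SpinChain.charge v H C n p) ∧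
        SpinChain.opRange (SpinChain.charge v H C n p) ≤ (n : ℕ∞)) ∧
    -- they are translation-invariant conserved quantities
    (∀ n : ℕ, 2 ≤ n → ∀ p ∈ U,
      SpinChain.IsTranslationInvariant (SpinChain.charge v H C n p) ∧
        SpinChain.IsConserved (H p) (SpinChain.charge v H C n p)) ∧
    -- and commute with each other
    (∀ m n : ℕ, 2 ≤ m → 2 ≤ n → ∀ p ∈ U,
      SpinChain.comm (SpinChain.charge v H C m p) (SpinChain.charge v H C n p) = 0) := by
  have : NeZero d := ⟨hd.ne'⟩
  have hH : ∀ p ∈ U, SpinChain.IsLoc 2 (H p) := fun p hp => (hH_nn p hp).isLoc (hH_traceless p hp)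
  have hC : ∀ p ∈ U, SpinChain.IsLoc 1 (C p) := fun p hp =>
    ⟨hC_traceless p hp, SpinChain.opRange_le_iff.1 (by exact_mod_cast hC_local p hp)⟩
  have hQ : ∀ n, 2 ≤ n → SpinChain.IsConservedFamily U H n (SpinChain.charge v H C n) := by
    intro n hn
    induction n, hn using Nat.le_induction with
    | base =>
      exact ⟨hH_smooth, hH, hH_inv, fun p hp => SpinChain.comm_self (hH p hp)⟩
    | succ n hn ih =>
      rw [SpinChain.charge_succ hn]
      exact ih.succ hU hv hH (fun p hp => (hH_nn p hp).apply_empty) hH_sa hH_inv hH_smooth hC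
        hC_inv hC_smooth rfl hQ3
  refine ⟨fun n hn => ⟨(hQ n hn).smooth, fun p hp => ⟨((hQ n hn).loc p hp).traceless,
    ((hQ n hn).loc p hp).opRange_le⟩⟩, fun n hn p hp => ⟨(hQ n hn).inv p hp,
    (hQ n hn).conserved p hp⟩, fun m n hm => ?_⟩
  -- The step for `(m + 1, n)` uses the hypothesis at both `(m, n)` and `(m, n + 1)`, so `n` stays
  -- general.
  induction m, hm using Nat.le_induction generalizing n with
  | base => exact fun hn p hp => (hQ n hn).conserved p hp
  | succ m hm ih =>
    intro hn p hp
    have h := SpinChain.comm_derivation_add_comm_derivation (v := v) hU hp (hQ m hm).smooth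
      (hQ n hn).smooth (hQ m hm).loc (hQ n hn).loc (SpinChain.boost_isLoc (hH p hp) (hC p hp))
      (ih n hn)
    have hm1 := congrFun (SpinChain.charge_succ (v := v) (H := H) (C := C) hm) p
    have hn1 := congrFun (SpinChain.charge_succ (v := v) (H := H) (C := C) hn) p
    rwa [← hm1, ← hn1, ih (n + 1) (Nat.le_succ_of_le hn) p hp, add_zero] at h
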